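/- **Theorem 3.1.** *Setting.* Fix $\rho>1$. For each horizon $T\ge 2$ let $P_1=P_{1,T}$ and $P_2=P_{2,T}$ be probability distributions on $[0,1]$ (which may vary with $T$), with means $\mu_1\ge\mu_2$ and standard deviations $\sigma_1,\sigma_2\ge 0$, and put $\Delta_2=\mu_1-\mu_2$, $$\overline\sigma_a=\frac{\sigma_a}{\sqrt{\rho\log T}},\qquad \overline\Delta_2=\frac{\Delta_2}{\rho\log T},\qquad \varphi(n;\sigma)=\frac{\sigma\vee n^{-1/2}}{\sqrt n}\quad(n>0,\ \sigma\ge0).$$ Run the two-armed UCB-V algorithm with horizon $T$ and exploration coefficient $\rho$: in each round $t=1,\dots,T$ an arm $A_t\in\{1,2\}$ is chosen from the information available before round $t$ (the past arms and rewards and possibly external randomization), and a reward $X_t$ is then drawn from $P_{A_t}$, conditionally on that information and on $A_t$. Each arm is pulled once in the first two rounds; for $3\le t\le T$, $A_t$ maximizes over $a\in\{1,2\}$ (ties being broken in any way) $$\mathrm{UCB}(a,t)=\bar X_{a,t}+\Big(\frac{\hat\sigma_{a,t}}{\sqrt{\rho\log T}}\vee\frac1{\sqrt{n_{a,t}}}\Big)\frac{\rho\log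 T}{\sqrt{n_{a,t}}},$$ where $n_{a,t}=\#\{1\le s\le t-1: A_s=a\}$, and $\bar X_{a,t}$ and $\hat\sigma_{a,t}^2=\frac1{n_{a,t}}\sum_{s\le t-1,\,A_s=a}(X_s-\bar X_{a,t})^2$ are the empirical mean and variance of the rewards of arm $a$ in rounds $1,\dots,t-1$. *Assumption.* $$\limsup_{T\to\infty}\ \Big\{\Big|\frac{\overline\sigma_2^2}{T\,\overline\Delta_2^2}-1\Big|^{-1}\wedge\frac{\overline\sigma_2}{\overline\sigma_1\vee T^{-1/2}}\Big\}<\infty,$$ where the first term is read as $+\infty$ if the ratio $\overline\sigma_2^2/(T\overline\Delta_2^2)$ equals $1$ and as $0$ if $\overline\Delta_2=0$. *Conclusion.* For every $T\ge2$ the equation $$\frac{\overline\sigma_1^2\vee\varphi(n;\overline\sigma_1)}{T\,\varphi(n;\overline\sigma_1)^2}+\frac{\overline\sigma_2^2\vee(\varphi(n;\overline\sigma_1)+\overline\Delta_2)}{T\,(\varphi(n;\overline\sigma_1)+\overline\Delta_2)^2}=1$$ has a unique solution $n=n^\star_{1,T}\in(0,\infty)$; and with $$n^\star_{2,T}=\frac{\overline\sigma_2^2\vee(\varphi(n^\star_{1,T};\overline\sigma_1)+\overline\Delta_2)}{(\varphi(n^\star_{1,T};\overline\sigma_1)+\overline\Delta_2)^2}$$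 one has, for $a=1,2$, $$\frac{n_{a,T}}{n^\star_{a,T}}\xrightarrow{\ p\ }1\qquad(T\to\infty).$$ -/

import Mathlib

open MeasureTheory ProbabilityTheory Filter Topology
open scoped ENNReal

noncomputable section

namespace UCBV

/-! ### Reward distributions -/

/-- Mean of a reward distribution. -/
def armMean (ν : Measure ℝ) : ℝ := ∫ x, x ∂ν

/-- Standard deviation of a reward distribution. -/
def armStd (ν : Measure ℝ) : ℝ := √(variance (fun x : ℝ => x) ν)

/-! ### The UCB-V algorithm

Rounds are numbered `t = 1, 2, …, T`; `A t ω` is the arm pulled and `X t ω` the reward observed in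
round `t`. -/

section Statistics

variable {Ω : Type*} {K : ℕ}

/-- `n_{a,t}`: the number of rounds `s ∈ {1, …, t - 1}` in which arm `a` was pulled. -/
def pullCount (A : ℕ → Ω → Fin K) (a : Fin K) (t : ℕ) (ω : Ω) : ℕ :=
  ((Finset.Ico 1 t).filter (fun s => A s ω = a)).card

/-- Empirical mean of arm `a` over the rounds `1, …, t - 1`. -/
def empMean (A : ℕ → Ω → Fin K) (X : ℕ → Ω → ℝ) (a : Fin K) (t : ℕ) (ω : Ω) : ℝ :=
  (∑ s ∈ (Finset.Ico 1 t).filter (fun s => A s ω = a), X s ω) / (pullCount A a t ω : ℝ)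

/-- Empirical variance of arm `a` over the rounds `1, …, t - 1`. -/
def empVar (A : ℕ → Ω → Fin K) (X : ℕ → Ω → ℝ) (a : Fin K) (t : ℕ) (ω : Ω) : ℝ :=
  (∑ s ∈ (Finset.Ico 1 t).filter (fun s => A s ω = a), (X s ω - empMean A X a t ω) ^ 2) /
    (pullCount A a t ω : ℝ)

/-- The optimistic reward `UCB(a, t)` with exploration coefficient `ρ` and horizon `T`. -/
def ucb (ρ : ℝ) (T : ℕ) (A : ℕ → Ω → Fin K) (X : ℕ → Ω → ℝ) (a : Fin K) (t : ℕ) (ω : Ω) : ℝ :=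
  empMean A X a t ω +
    max (√(empVar A X a t ω) / √(ρ * Real.log T)) (1 / √(pullCount A a t ω : ℝ)) *
      (ρ * Real.log T / √(pullCount A a t ω : ℝ))

/-- `(A, X)` is a run of UCB-V with exploration coefficient `ρ` up to horizon `T` on the `K`-armed
bandit with reward distributions `ν`, on the probability space `(Ω, P)`. The σ-algebra `ℱ t` is the
information available after round `t`: it contains at least the arms and rewards of the first `t`
rounds, and possibly external randomization used to break ties (or to order the first pulls). -/
structure IsRun [MeasurableSpace Ω] (ρ : ℝ) (T : ℕ) (ν : Fin K → Measure ℝ) (P : Measure Ω)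
    (ℱ : Filtration ℕ (inferInstance : MeasurableSpace Ω))
    (A : ℕ → Ω → Fin K) (X : ℕ → Ω → ℝ) : Prop where
  /-- The arm of round `t` is chosen from what is known before round `t`. -/
  measurable_arm : ∀ t ∈ Finset.Icc 1 T, Measurable[ℱ (t - 1)] (A t)
  /-- The reward of round `t` is observed in round `t`. -/
  measurable_reward : ∀ t ∈ Finset.Icc 1 T, Measurable[ℱ t] (X t)
  /-- Given the past, and given that arm `a` is pulled in round `t`, the reward has law `ν a`
  (that is, it is drawn from `ν a` independently of the past). -/
  law_reward : ∀ t ∈ Finset.Icc 1 T, ∀ (a : Fin K) (H : Set Ω) (B : Set ℝ),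
    MeasurableSet[ℱ (t - 1)] H → MeasurableSet B →
      P (H ∩ {ω | A t ω = a} ∩ {ω | X t ω ∈ B}) = P (H ∩ {ω | A t ω = a}) * ν a B
  /-- Every arm is pulled (hence pulled exactly once) in the first `K` rounds. -/
  init : ∀ (ω : Ω) (a : Fin K), ∃ t ∈ Finset.Icc 1 K, A t ω = a
  /-- Afterwards an arm maximizing the optimistic reward is pulled; ties are broken in any way. -/
  greedy : ∀ t ∈ Finset.Icc (K + 1) T, ∀ (ω : Ω) (b : Fin K),
    ucb ρ T A X b t ω ≤ ucb ρ T A X (A t ω) t ω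

end Statistics

/-! ### Normalized quantities and the deterministic equation (two arms)

Arm `0 : Fin 2` is the optimal arm (arm 1 in the text), arm `1 : Fin 2` is the other arm (arm 2). -/

/-- `σ̄ = σ / √(ρ log T)`. -/
def sigmaBar (ρ : ℝ) (T : ℕ) (ν : Measure ℝ) : ℝ := armStd ν / √(ρ * Real.log T)

/-- `Δ̄₂ = (μ₁ - μ₂) / (ρ log T)`. -/
def deltaBar (ρ : ℝ) (T : ℕ) (ν : Fin 2 → Measure ℝ) : ℝ :=
  (armMean (ν 0) - armMean (ν 1)) / (ρ * Real.log T)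

/-- `φ(n; σ) = (σ ∨ n^{-1/2}) / √n`. -/
def phi (n σ : ℝ) : ℝ := max σ (1 / √n) / √n

/-- `|σ̄₂² / (T Δ̄₂²) - 1|⁻¹ ∧ σ̄₂ / (σ̄₁ ∨ T^{-1/2})` as an extended nonnegative number:
the first term is `∞` if the ratio `σ̄₂² / (T Δ̄₂²)` equals `1`, and it is `0` if `Δ̄₂ = 0`
(the ratio is then infinite; if also `σ̄₂ = 0`, the second term is `0` anyway). -/
def stabilityQuantity (ρ : ℝ) (T : ℕ) (ν : Fin 2 → Measure ℝ) : ℝ≥0∞ :=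
  min
    (if deltaBar ρ T ν = 0 then 0
      else (ENNReal.ofReal
        |sigmaBar ρ T (ν 1) ^ 2 / ((T : ℝ) * deltaBar ρ T ν ^ 2) - 1|)⁻¹)
    (ENNReal.ofReal (sigmaBar ρ T (ν 1) / max (sigmaBar ρ T (ν 0)) (1 / √(T : ℝ))))

/-- `n > 0` solves the fixed-point equation for the number of pulls of the optimal arm. -/
def IsFixedPoint (ρ : ℝ) (T : ℕ) (ν : Fin 2 → Measure ℝ) (n : ℝ) : Prop :=
  0 < n ∧
    max (sigmaBar ρ T (ν 0) ^ 2) (phi n (sigmaBar ρ T (ν 0))) /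
        ((T : ℝ) * phi n (sigmaBar ρ T (ν 0)) ^ 2) +
      max (sigmaBar ρ T (ν 1) ^ 2) (phi n (sigmaBar ρ T (ν 0)) + deltaBar ρ T ν) /
        ((T : ℝ) * (phi n (sigmaBar ρ T (ν 0)) + deltaBar ρ T ν) ^ 2) = 1

/-- `n*_{2,T}` as a function of `n = n*_{1,T}`. -/
def secondCount (ρ : ℝ) (T : ℕ) (ν : Fin 2 → Measure ℝ) (n : ℝ) : ℝ :=
  max (sigmaBar ρ T (ν 1) ^ 2) (phi n (sigmaBar ρ T (ν 0)) + deltaBar ρ T ν) /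
    (phi n (sigmaBar ρ T (ν 0)) + deltaBar ρ T ν) ^ 2

/-- `Y T → c` in probability as `T → ∞`, where each `Y T` lives on its own probability space. -/
def TendstoInProb {Ω : ℕ → Type*} [∀ T, MeasurableSpace (Ω T)] (P : ∀ T, Measure (Ω T))
    (Y : ∀ T, Ω T → ℝ) (c : ℝ) : Prop :=
  ∀ ε : ℝ, 0 < ε → Tendsto (fun T => P T {ω | ε ≤ |Y T ω - c|}) atTop (𝓝 0)

end UCBV

end

/-!
Divide the optimistic rewards by `L = ρ * log T`. If empirical means and variances are replaced
by the true ones, UCB-V pulls the arm with the larger value of `μ / L + phi n σ̄`. At the last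
pull of each arm its value is at least that of the other one, so at the horizon the two values
nearly agree: `phi n₂ σ̄₂ ≈ phi n₁ σ̄₁ + Δ̄₂`. Since `n₁ + n₂ = T - 1`, this says that
`x = phi n₁ σ̄₁` nearly solves `G x = T`, where `G x = pulls σ̄₁ x + pulls σ̄₂ (x + Δ̄₂)`
and `pulls σ` is the inverse of `phi · σ`. The exact solution of `G x = T` is the deterministic fixed point.

*Concentration.* The bonus `L * phi n σ̄` exceeds the typical deviation of the empirical mean,
uniformly over the number of pulls, by a factor that grows with `T`: a uniform deviation is
governed by an iterated logarithm of `T`, the bonus by `log T`. To prove it, Ville's inequality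
(`mul_measure_exists_le_lintegral`) is applied to exponential supermartingales, which keeps all
centered sums below a line; `O(log T)` lines have an envelope below a small multiple `δ` of the
bonus (`exists_line_le`), and each of them fails with probability at most `T ^ (-c)` for some
`c = c(δ, ρ) > 0`. The same bound applied to the squared deviations controls the empirical
variances. Hence (`IsRun.measure_not_ucb_close_le`) all optimistic rewards are within a small
fraction of the bonus from their deterministic counterparts, with probability tending to `1`.

*Stability.* `G x ≈ T` determines `x` up to a factor near `1` unless `G` is flat near its
solution (`bonus_stable`). Each `pulls σ` has elasticity between `-2` and `-1`, so `G` is flat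
only if `x` is negligible compared with `Δ̄₂` and the first arm receives a negligible fraction
of the pulls. The stability assumption rules this out (`pulls_ge_or_bonus_ge`): in that regime
`σ̄₂ ^ 2 / (T * Δ̄₂ ^ 2)` would be close to `1` while `σ̄₂` would be large compared with `σ̄₁`
and `1 / √T`.
-/

namespace UCBV

/-! ### The bonus function and its inverse -/

/-- The inverse of `n ↦ phi n σ` on `(0, ∞)`: the number of pulls after which an arm with normalized
standard deviation `σ` has normalized exploration bonus `x`. -/
noncomputable def pulls (σ x : ℝ) : ℝ := max (σ ^ 2) x / x ^ 2

lemma phi_eq_max {n : ℝ} (hn : 0 < n) (σ : ℝ) : phi n σ = max (σ / √n) (1 / n) := by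
  have hs : 0 < √n := Real.sqrt_pos.2 hn
  rw [phi, ← max_div_div_right hs.le, div_div, Real.mul_self_sqrt hn.le]

lemma one_div_le_phi {n : ℝ} (hn : 0 < n) (σ : ℝ) : 1 / n ≤ phi n σ := by
  rw [phi_eq_max hn]; exact le_max_right _ _

lemma phi_pos {n : ℝ} (hn : 0 < n) (σ : ℝ) : 0 < phi n σ :=
  (one_div_pos.2 hn).trans_le (one_div_le_phi hn σ)

lemma phi_anti {n m σ : ℝ} (hn : 0 < n) (hnm : n ≤ m) (hσ : 0 ≤ σ) : phi m σ ≤ phi n σ := by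
  have hs : 0 < √n := Real.sqrt_pos.2 hn
  rw [phi_eq_max hn, phi_eq_max (hn.trans_le hnm)]
  gcongr

lemma mul_phi {n : ℝ} (hn : 0 < n) (σ : ℝ) : n * phi n σ = max (σ * √n) 1 := by
  have hs : 0 < √n := Real.sqrt_pos.2 hn
  rw [phi_eq_max hn, mul_max_of_nonneg _ _ hn.le, mul_one_div_cancel hn.ne']
  congr 1
  nth_rewrite 1 [← Real.mul_self_sqrt hn.le]
  field_simp

lemma mul_phi_mono {n m σ : ℝ} (hn : 0 < n) (hnm : n ≤ m) (hσ : 0 ≤ σ) :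
    n * phi n σ ≤ m * phi m σ := by
  rw [mul_phi hn, mul_phi (hn.trans_le hnm)]
  gcongr

lemma phi_le_one_div_sqrt {n σ : ℝ} (hn : 1 ≤ n) (hσ : σ ≤ 1) : phi n σ ≤ 1 / √n := by
  have hs : 1 ≤ √n := Real.one_le_sqrt.2 hn
  rw [phi]
  gcongr
  exact max_le hσ ((div_le_one (by linarith)).2 hs)

lemma continuousOn_phi (σ : ℝ) : ContinuousOn (fun n => phi n σ) (Set.Ioi 0) := by
  have h : ∀ n ∈ Set.Ioi (0 : ℝ), √n ≠ 0 := fun n hn => (Real.sqrt_pos.2 hn).ne'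
  unfold phi
  exact (continuousOn_const.sup (continuousOn_const.div Real.continuous_sqrt.continuousOn h)).div
    Real.continuous_sqrt.continuousOn h

lemma pulls_eq_max {x : ℝ} (hx : 0 < x) (σ : ℝ) : pulls σ x = max (σ ^ 2 / x ^ 2) (1 / x) := by
  rw [pulls, ← max_div_div_right (by positivity)]
  congr 1
  field_simp

lemma one_div_le_pulls {x : ℝ} (hx : 0 < x) (σ : ℝ) : 1 / x ≤ pulls σ x := by
  rw [pulls_eq_max hx]; exact le_max_right _ _

lemma sq_div_sq_le_pulls {x : ℝ} (hx : 0 < x) (σ : ℝ) : σ ^ 2 / x ^ 2 ≤ pulls σ x := by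
  rw [pulls_eq_max hx]; exact le_max_left _ _

lemma pulls_pos {x : ℝ} (hx : 0 < x) (σ : ℝ) : 0 < pulls σ x :=
  (one_div_pos.2 hx).trans_le (one_div_le_pulls hx σ)

lemma pulls_phi {n σ : ℝ} (hn : 0 < n) (hσ : 0 ≤ σ) : pulls σ (phi n σ) = n := by
  have hs : 0 < √n := Real.sqrt_pos.2 hn
  have hsq : √n ^ 2 = n := Real.sq_sqrt hn.le
  have hp : phi n σ ≠ 0 := (phi_pos hn σ).ne'
  rw [pulls, div_eq_iff (by positivity)]
  rcases le_total σ (1 / √n) with h | h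
  · have h1 : phi n σ = 1 / n := by rw [phi, max_eq_right h, div_div, Real.mul_self_sqrt hn.le]
    have h2 : σ ^ 2 ≤ 1 / n := by
      calc σ ^ 2 ≤ (1 / √n) ^ 2 := by gcongr
        _ = 1 / n := by rw [div_pow, hsq, one_pow]
    rw [h1, max_eq_right h2]
    field_simp
  · have h1 : phi n σ = σ / √n := by rw [phi, max_eq_left h]
    have h2 : σ / √n ≤ σ ^ 2 := by
      calc σ / √n = σ * (1 / √n) := by ring
        _ ≤ σ * σ := by gcongr
        _ = σ ^ 2 := by ring
    rw [h1, max_eq_left h2, div_pow, hsq]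
    field_simp

/-- Multiplying the bonus by at least `q` divides the number of pulls by at least `q`. -/
lemma mul_pulls_le {σ q x y : ℝ} (hx : 0 < x) (hq : 1 ≤ q) (h : q * x ≤ y) :
    q * pulls σ y ≤ pulls σ x := by
  have hy : 0 < y := by nlinarith
  rw [pulls_eq_max hx, pulls_eq_max hy, mul_max_of_nonneg _ _ (by linarith)]
  refine max_le_max ?_ ?_
  · rw [mul_div_assoc', div_le_div_iff₀ (by positivity) (by positivity)]
    have : q * x ^ 2 ≤ y ^ 2 := by
      calc q * x ^ 2 ≤ q * q * x ^ 2 := by gcongr; nlinarith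
        _ = (q * x) ^ 2 := by ring
        _ ≤ y ^ 2 := by gcongr
    nlinarith [sq_nonneg σ]
  · rw [mul_div_assoc', div_le_div_iff₀ hy hx]
    linarith

lemma pulls_anti {σ x y : ℝ} (hx : 0 < x) (h : x ≤ y) : pulls σ y ≤ pulls σ x := by
  simpa using mul_pulls_le (σ := σ) hx le_rfl (by simpa using h)

/-- Multiplying the bonus by at most `s` divides the number of pulls by at most `s ^ 2`. -/
lemma pulls_le_sq_mul {σ s x y : ℝ} (hx : 0 < x) (hy : 0 < y) (hs : 1 ≤ s) (h : y ≤ s * x) :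
    pulls σ x ≤ s ^ 2 * pulls σ y := by
  rw [pulls_eq_max hx, pulls_eq_max hy, mul_max_of_nonneg _ _ (by positivity)]
  refine max_le_max ?_ ?_
  · rw [mul_div_assoc', div_le_div_iff₀ (by positivity) (by positivity)]
    have : y ^ 2 ≤ s ^ 2 * x ^ 2 := by
      calc y ^ 2 ≤ (s * x) ^ 2 := by gcongr
        _ = _ := by ring
    nlinarith [sq_nonneg σ]
  · rw [mul_div_assoc', div_le_div_iff₀ hx hy]
    nlinarith [mul_pos (by linarith : 0 < s) hx]

lemma continuousOn_pulls (σ : ℝ) : ContinuousOn (pulls σ) (Set.Ioi 0) := by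
  unfold pulls
  exact (continuousOn_const.sup continuousOn_id).div (continuousOn_id.pow 2)
    fun x hx => pow_ne_zero 2 (ne_of_gt hx)

/-! ### The deterministic equation and its stability -/

theorem existsUnique_add_pulls {T σ₁ σ₂ Δ : ℝ} (hT : 2 ≤ T) (hσ₁ : 0 ≤ σ₁) (hΔ : 0 ≤ Δ) :
    ∃! n : ℝ, 0 < n ∧ n + pulls σ₂ (phi n σ₁ + Δ) = T := by
  set h : ℝ → ℝ := fun n => n + pulls σ₂ (phi n σ₁ + Δ)
  have hpos : ∀ n : ℝ, 0 < n → 0 < phi n σ₁ + Δ := fun n hn => by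
    linarith [phi_pos hn σ₁]
  have hmono : ∀ n m : ℝ, 0 < n → n < m → h n < h m := fun n m hn hnm => by
    have := pulls_anti (σ := σ₂) (hpos m (hn.trans hnm))
      (add_le_add_left (phi_anti hn hnm.le hσ₁) Δ)
    simp only [h]; linarith
  have hcont : ContinuousOn h (Set.Ioi 0) :=
    continuousOn_id.add ((continuousOn_pulls σ₂).comp
      ((continuousOn_phi σ₁).add continuousOn_const) fun n hn => hpos n hn)
  -- at the left end `m` the bonus is at least `1 / m`, so both terms of `h m` are at most `1`
  set m : ℝ := 1 / (1 + σ₂ ^ 2) with hm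
  have hm0 : 0 < m := by positivity
  have hm1 : m ≤ 1 := (div_le_one (by positivity)).2 (by nlinarith [sq_nonneg σ₂])
  have hle : h m ≤ T := by
    have h1 : pulls σ₂ (phi m σ₁ + Δ) ≤ pulls σ₂ (1 / m) :=
      pulls_anti (by positivity) (by linarith [one_div_le_phi hm0 σ₁])
    have h2 : pulls σ₂ (1 / m) ≤ 1 := by
      rw [pulls, div_le_one (by positivity), hm]
      simp only [one_div_one_div]
      exact max_le (by nlinarith [sq_nonneg σ₂, sq_nonneg (σ₂ ^ 2)])
        (by nlinarith [sq_nonneg σ₂, sq_nonneg (σ₂ ^ 2)])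
    simp only [h]; linarith
  have hge : T ≤ h T := by
    have := pulls_pos (hpos T (by linarith)) σ₂
    simp only [h]; linarith
  obtain ⟨n, hn, hnT⟩ := intermediate_value_Icc (by linarith : m ≤ T)
    (hcont.mono fun y hy => hm0.trans_le hy.1) ⟨hle, hge⟩
  have hn0 : 0 < n := hm0.trans_le hn.1
  refine ⟨n, ⟨hn0, hnT⟩, fun k hk => ?_⟩
  rcases lt_trichotomy k n with hlt | heq | hlt
  · exact absurd (hk.2.trans hnT.symm) (hmono k n hk.1 hlt).ne
  · exact heq
  · exact absurd (hk.2.trans hnT.symm) (hmono n k hn0 hlt).ne'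

/-- The stability assumption excludes that the first arm is pulled a vanishing fraction of the time
while its bonus is negligible with respect to the gap: this is the one regime where `G` is too flat
for its level to determine the bonus. -/
lemma pulls_ge_or_bonus_ge {C : ℝ} (hC : 1 ≤ C) :
    ∃ c : ℝ, 0 < c ∧ ∀ T σ₁ σ₂ Δ x : ℝ, 0 < T → 0 ≤ σ₁ → 0 ≤ σ₂ → 0 ≤ Δ → 0 < x →
      (Δ = 0 ∨ 1 / C ≤ |σ₂ ^ 2 / (T * Δ ^ 2) - 1| ∨ σ₂ ≤ C * max σ₁ (1 / √T)) →
      pulls σ₁ x + pulls σ₂ (x + Δ) = T →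
      c * T ≤ pulls σ₁ x ∨ c * Δ ≤ x := by
  have hC0 : 0 < C := by linarith
  refine ⟨1 / (4 * C ^ 2), by positivity, fun T σ₁ σ₂ Δ x hT hσ₁ hσ₂ hΔ hx hH hG => ?_⟩
  set c := 1 / (4 * C ^ 2) with hc
  have hc0 : 0 < c := by positivity
  have hcC : c * C ^ 2 = 1 / 4 := by rw [hc]; field_simp
  have hcC1 : c * C ≤ 1 / 4 := by nlinarith
  have hc4 : c ≤ 1 / 4 := by nlinarith
  by_contra! hcon
  obtain ⟨hN, hxΔ⟩ := hcon
  have hΔ0 : 0 < Δ := by nlinarith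
  have hxΔ' : x < Δ := by nlinarith
  have hN1 := one_div_le_pulls hx σ₁
  have hN1' := sq_div_sq_le_pulls hx σ₁
  have hinv : 1 / Δ ≤ 1 / x := by gcongr
  have hN2 : pulls σ₂ (x + Δ) ≤ max (σ₂ ^ 2 / Δ ^ 2) (1 / Δ) := by
    rw [← pulls_eq_max hΔ0]; exact pulls_anti hΔ0 (by linarith)
  have hcT : c * T ≤ T / 4 := by nlinarith
  -- the second arm takes most of the pulls, hence more than `1 / Δ ≤ 1 / x ≤ pulls σ₁ x`
  have hN2' : pulls σ₂ (x + Δ) ≤ σ₂ ^ 2 / Δ ^ 2 := by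
    rcases le_max_iff.1 hN2 with h | h
    · exact h
    · linarith
  rcases hH with h | h | h
  · exact hΔ0.ne' h
  · have hr : σ₂ ^ 2 / Δ ^ 2 = σ₂ ^ 2 / (T * Δ ^ 2) * T := by field_simp
    set r := σ₂ ^ 2 / (T * Δ ^ 2)
    have hCi' : c * 4 * C = 1 / C := by rw [hc]; field_simp
    rcases le_abs.1 h with h | h
    -- for `r` well above `1` the second arm alone would need more than `T` pulls
    · have h1 : σ₂ ^ 2 / (x + Δ) ^ 2 ≤ pulls σ₂ (x + Δ) := sq_div_sq_le_pulls (by linarith) σ₂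
      have h2 : σ₂ ^ 2 / (x + Δ) ^ 2 < T := by linarith [pulls_pos hx σ₁]
      rw [div_lt_iff₀ (by positivity)] at h2
      rw [div_eq_iff (by positivity)] at hr
      have h3 : (x + Δ) ^ 2 ≤ (1 + 4 * c) * Δ ^ 2 := by
        have h31 : x * Δ ≤ c * Δ * Δ := by gcongr
        have h32 : x * x ≤ c * Δ * Δ := by gcongr
        have : 0 ≤ c * Δ * Δ := by positivity
        nlinarith only [h31, h32, this]
      have h4 : 1 + 4 * c ≤ r := by
        have : 4 * c ≤ 4 * c * C := le_mul_of_one_le_right (by positivity) hC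
        linarith
      have h5 : T * (x + Δ) ^ 2 ≤ T * ((1 + 4 * c) * Δ ^ 2) := by gcongr
      have h6 : (1 + 4 * c) * (T * Δ ^ 2) ≤ r * (T * Δ ^ 2) := by gcongr
      linarith
    -- for `r` well below `1` it leaves a fraction `1 / C` of the pulls to the first arm
    · have : r * T ≤ (1 - 1 / C) * T := by gcongr; linarith
      have : 1 / C * T = 4 * C * (c * T) := by rw [← hCi']; ring
      have : 1 * (c * T) ≤ 4 * C * (c * T) := by gcongr; linarith
      linarith
  -- with `σ₂` at most of the order of `max σ₁ (1 / √T)`, the arm with the much smaller bonus `x`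
  -- needs most of the pulls
  · rcases le_total σ₁ (1 / √T) with hm | hm
    · rw [max_eq_right hm] at h
      have h1 : σ₂ ^ 2 ≤ C ^ 2 / T := by
        calc σ₂ ^ 2 ≤ (C * (1 / √T)) ^ 2 := by gcongr
          _ = C ^ 2 / T := by rw [mul_one_div, div_pow, Real.sq_sqrt hT.le]
      have h2 : 1 / Δ ≤ T := by linarith [pulls_pos (by linarith : 0 < x + Δ) σ₂]
      have h3 : σ₂ ^ 2 / Δ ^ 2 ≤ C ^ 2 * (1 / Δ) := by
        calc σ₂ ^ 2 / Δ ^ 2 ≤ C ^ 2 / T / Δ ^ 2 := by gcongr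
          _ = C ^ 2 * (1 / Δ * (1 / Δ / T)) := by field_simp
          _ ≤ C ^ 2 * (1 / Δ * 1) := by
            gcongr
            exact (div_le_one hT).2 h2
          _ = _ := by ring
      have h4 : C ^ 2 * (1 / Δ) ≤ C ^ 2 * (c * T) := by
        gcongr; linarith
      have h5 : C ^ 2 * (c * T) = T / 4 := by linear_combination T * hcC
      linarith
    · rw [max_eq_left hm] at h
      have h3 : σ₂ ^ 2 / Δ ^ 2 ≤ C ^ 2 * (c * T) := by
        calc σ₂ ^ 2 / Δ ^ 2 ≤ (C * σ₁) ^ 2 / x ^ 2 := by gcongr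
          _ = C ^ 2 * (σ₁ ^ 2 / x ^ 2) := by ring
          _ ≤ _ := by gcongr; linarith
      have h5 : C ^ 2 * (c * T) = T / 4 := by linear_combination T * hcC
      linarith

/-- Under the stability assumption, the bonus of the first arm is determined up to a factor close to
`1` by the total number of pulls `G`, if the latter is known up to a factor close to `1`. -/
lemma bonus_stable {C s : ℝ} (hC : 1 ≤ C) (hs : 1 < s) :
    ∃ r : ℝ, 1 < r ∧ r ≤ s ∧ ∀ T σ₁ σ₂ Δ x z : ℝ, 0 < T → 0 ≤ σ₁ → 0 ≤ σ₂ → 0 ≤ Δ →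
      0 < x → 0 < z →
      (Δ = 0 ∨ 1 / C ≤ |σ₂ ^ 2 / (T * Δ ^ 2) - 1| ∨ σ₂ ≤ C * max σ₁ (1 / √T)) →
      pulls σ₁ z + pulls σ₂ (z + Δ) = T →
      pulls σ₁ x + pulls σ₂ (x + Δ) ≤ r * T →
      T ≤ r * (pulls σ₁ x + pulls σ₂ (x + Δ)) →
      x ≤ s * z ∧ z ≤ s * x := by
  obtain ⟨c, hc, hdich⟩ := pulls_ge_or_bonus_ge hC
  -- if `c * Δ ≤ z`, a change of the bonus by the factor `s` changes `x + Δ`, and hence `G`, by at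
  -- least the factor `1 + e`
  set e := c * (s - 1) / (c + s) with he
  have he0 : 0 < e := by have : 0 < s - 1 := by linarith
                         positivity
  have hes : e * (c + s) = c * (s - 1) := by rw [he]; field_simp
  have hes' : e < s - 1 := by nlinarith
  refine ⟨1 + e / 2, by linarith, by linarith, ?_⟩
  intro T σ₁ σ₂ Δ x z hT hσ₁ hσ₂ hΔ hx hz hH hG hle hge
  have hN1 := pulls_pos hz σ₁
  have hN2 := pulls_pos (by linarith : 0 < z + Δ) σ₂
  have hM1 := pulls_pos hx σ₁
  have hM2 := pulls_pos (by linarith : 0 < x + Δ) σ₂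
  have key := hdich T σ₁ σ₂ Δ z hT hσ₁ hσ₂ hΔ hz hH hG
  constructor
  · by_contra! hcon
    have hzx : z ≤ x := by nlinarith
    have h1 : s * pulls σ₁ x ≤ pulls σ₁ z := mul_pulls_le hz hs.le hcon.le
    rcases key with h | h
    · have h2 : pulls σ₂ (x + Δ) ≤ pulls σ₂ (z + Δ) := pulls_anti (by linarith) (by linarith)
      have h3 : pulls σ₁ z ≤ (1 + e / 2) * pulls σ₁ x + e / 2 * T := by nlinarith
      have h4 : s * c * pulls σ₁ z ≤ (1 + e / 2) * c * pulls σ₁ z + e / 2 * s * pulls σ₁ z := by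
        nlinarith [mul_le_mul_of_nonneg_left h3 (by positivity : 0 ≤ s * c),
          mul_le_mul_of_nonneg_left h1 (by positivity : 0 ≤ (1 + e / 2) * c),
          mul_le_mul_of_nonneg_left h (by positivity : 0 ≤ e / 2 * s)]
      have h5 : s * c ≤ (1 + e / 2) * c + e / 2 * s := by
        refine le_of_mul_le_mul_right ?_ hN1; linarith
      nlinarith
    · have h2 : (1 + e) * (z + Δ) ≤ x + Δ := by
        have : c * (e * Δ) ≤ c * (x - (1 + e) * z) := by
          have h21 : e * (c * Δ) ≤ e * z := by gcongr
          have h22 : c * (s * z) ≤ c * x := by gcongr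
          have h23 : c * (s * z) - c * ((1 + e) * z) = e * z * s := by
            linear_combination (-z) * hes
          have h24 : e * z ≤ e * z * s := le_mul_of_one_le_right (by positivity) hs.le
          linarith
        have := le_of_mul_le_mul_left this hc
        linarith
      have h3 := mul_pulls_le (σ := σ₂) (by linarith) (by linarith) h2
      have h4 : (1 + e) * pulls σ₁ x ≤ s * pulls σ₁ x := by gcongr; linarith
      nlinarith
  · by_contra! hcon
    have hzx : x ≤ z := by nlinarith
    have h1 : s * pulls σ₁ z ≤ pulls σ₁ x := mul_pulls_le hx hs.le hcon.le
    rcases key with h | h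
    · have h2 : pulls σ₂ (z + Δ) ≤ pulls σ₂ (x + Δ) := pulls_anti (by linarith) (by linarith)
      have h3 : s * pulls σ₁ z ≤ pulls σ₁ z + e / 2 * T := by nlinarith
      have h4 : c * s * pulls σ₁ z ≤ c * pulls σ₁ z + e / 2 * pulls σ₁ z := by
        nlinarith [mul_le_mul_of_nonneg_left h3 hc.le,
          mul_le_mul_of_nonneg_left h (by positivity : 0 ≤ e / 2)]
      have h5 : c * s ≤ c + e / 2 := by
        refine le_of_mul_le_mul_right ?_ hN1; linarith
      nlinarith
    · have h2 : (1 + e) * (x + Δ) ≤ z + Δ := by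
        have : (c * s) * (e * Δ) ≤ (c * s) * (z - (1 + e) * x) := by
          have h21 : e * s * (c * Δ) ≤ e * s * z := by gcongr
          have h22 : (1 + e) * c * (s * x) ≤ (1 + e) * c * z := by gcongr
          have h23 : c * s * z - (1 + e) * c * z = e * s * z := by
            linear_combination (-z) * hes
          linarith
        have := le_of_mul_le_mul_left this (by positivity)
        linarith
      have h3 := mul_pulls_le (σ := σ₂) (by linarith) (by linarith) h2
      have h4 : (1 + e) * pulls σ₁ z ≤ s * pulls σ₁ z := by gcongr; linarith
      nlinarith

/-- Pull counts that balance the bonuses, up to a factor `1 ± δ` and a shift by one pull, agree with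
the solution of the deterministic equation up to a factor close to `1`. -/
lemma counts_close {C s : ℝ} (hC : 1 ≤ C) (hs : 1 < s) :
    ∃ δ : ℝ, 0 < δ ∧ δ ≤ 1 / 2 ∧ ∃ M : ℝ, ∀ T σ₁ σ₂ Δ n₁ n₂ m : ℝ,
      0 ≤ σ₁ → 0 ≤ σ₂ → 0 ≤ Δ → 2 ≤ n₁ → 2 ≤ n₂ → M ≤ n₁ → M ≤ n₂ → n₁ + n₂ + 1 = T →
      (Δ = 0 ∨ 1 / C ≤ |σ₂ ^ 2 / (T * Δ ^ 2) - 1| ∨ σ₂ ≤ C * max σ₁ (1 / √T)) →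
      (1 - δ) * phi n₁ σ₁ + Δ ≤ (1 + δ) * phi (n₂ - 1) σ₂ →
      (1 - δ) * phi n₂ σ₂ ≤ (1 + δ) * phi (n₁ - 1) σ₁ + Δ →
      0 < m → m + pulls σ₂ (phi m σ₁ + Δ) = T →
      (n₁ ≤ s ^ 3 * m ∧ m ≤ s ^ 3 * n₁) ∧
        (n₂ ≤ s ^ 3 * pulls σ₂ (phi m σ₁ + Δ) ∧ pulls σ₂ (phi m σ₁ + Δ) ≤ s ^ 3 * n₂) := by
  obtain ⟨r, hr, hrs, hstab⟩ := bonus_stable hC hs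
  obtain ⟨δ, ⟨hδr, hδ0⟩, hδ2⟩ : ∃ δ : ℝ,
      ((1 + δ) * ((1 + δ) ^ 2 / (1 - δ)) ^ 2 < r ∧ 0 < δ) ∧ δ < 1 / 2 := by
    have hc : ContinuousAt (fun δ : ℝ => (1 + δ) * ((1 + δ) ^ 2 / (1 - δ)) ^ 2) 0 := by
      refine ContinuousAt.mul (by fun_prop) (ContinuousAt.pow (ContinuousAt.div ?_ ?_ ?_) 2)
      · fun_prop
      · fun_prop
      · norm_num
    have h1 : ∀ᶠ δ in 𝓝 (0 : ℝ), (1 + δ) * ((1 + δ) ^ 2 / (1 - δ)) ^ 2 < r :=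
      hc.eventually_lt continuousAt_const (by simpa using hr)
    have h2 : ∀ᶠ δ in 𝓝 (0 : ℝ), δ < 1 / 2 := eventually_lt_nhds (by norm_num)
    have h3 : ∀ᶠ δ in 𝓝[>] (0 : ℝ), 0 < δ := self_mem_nhdsWithin
    exact (((h1.filter_mono nhdsWithin_le_nhds).and h3).and
      (h2.filter_mono nhdsWithin_le_nhds)).exists
  refine ⟨δ, hδ0, hδ2.le, 2 / δ + 2, ?_⟩
  intro T σ₁ σ₂ Δ n₁ n₂ m hσ₁ hσ₂ hΔ hn₁ hn₂ hM₁ hM₂ hT hH h12 h21 hm hmT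
  set d := (1 + δ) ^ 2 / (1 - δ) with hd
  have hδ1 : 0 < 1 - δ := by linarith
  have hd' : d * (1 - δ) = (1 + δ) ^ 2 := by rw [hd]; field_simp
  have hd1 : 1 ≤ d := by rw [hd, le_div_iff₀ hδ1]; nlinarith
  have hpred : ∀ n σ : ℝ, 0 ≤ σ → 2 ≤ n → 2 / δ + 2 ≤ n →
      phi (n - 1) σ ≤ (1 + δ) * phi n σ := by
    intro n σ hσ hn hMn
    have h1 := mul_phi_mono (by linarith : 0 < n - 1) (by linarith : n - 1 ≤ n) hσ
    have h2 : 2 + 2 * δ ≤ δ * n := by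
      have := mul_le_mul_of_nonneg_left hMn hδ0.le
      have h3 : δ * (2 / δ + 2) = 2 + 2 * δ := by field_simp
      linarith
    have h3 : n ≤ (n - 1) * (1 + δ) := by nlinarith
    have h4 : n * phi n σ ≤ (n - 1) * (1 + δ) * phi n σ :=
      mul_le_mul_of_nonneg_right h3 (phi_pos (by linarith) σ).le
    refine le_of_mul_le_mul_left (a := n - 1) ?_ (by linarith)
    linarith
  have hx := phi_pos (by linarith : 0 < n₁) σ₁
  have hy := phi_pos (by linarith : 0 < n₂) σ₂
  have hz := phi_pos hm σ₁
  have hpx := pulls_phi (by linarith : 0 < n₁) hσ₁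
  have hpy := pulls_phi (by linarith : 0 < n₂) hσ₂
  have hpz := pulls_phi hm hσ₁
  have hp1 := hpred n₁ σ₁ hσ₁ hn₁ hM₁
  have hp2 := hpred n₂ σ₂ hσ₂ hn₂ hM₂
  set x := phi n₁ σ₁
  set y := phi n₂ σ₂
  set z := phi m σ₁
  have hxy : x + Δ ≤ d * y := by
    refine le_of_mul_le_mul_left (a := 1 - δ) ?_ hδ1
    have e1 : (1 - δ) * (d * y) = (1 + δ) ^ 2 * y := by rw [← hd']; ring
    have e2 : (1 + δ) * phi (n₂ - 1) σ₂ ≤ (1 + δ) * ((1 + δ) * y) := by gcongr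
    have e3 : 0 ≤ δ * Δ := by positivity
    linarith
  have hyx : y ≤ d * (x + Δ) := by
    refine le_of_mul_le_mul_left (a := 1 - δ) ?_ hδ1
    have e1 : (1 - δ) * (d * (x + Δ)) = (1 + δ) ^ 2 * (x + Δ) := by rw [← hd']; ring
    have e2 : (1 + δ) * phi (n₁ - 1) σ₁ ≤ (1 + δ) * ((1 + δ) * x) := by gcongr
    have e3 : 1 * Δ ≤ (1 + δ) ^ 2 * Δ := by gcongr; exact one_le_pow₀ (by linarith)
    linarith
  have hA : pulls σ₂ (x + Δ) ≤ d ^ 2 * n₂ := by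
    rw [← hpy]; exact pulls_le_sq_mul (by linarith) hy hd1 hyx
  have hB : n₂ ≤ d ^ 2 * pulls σ₂ (x + Δ) := by
    nth_rewrite 1 [← hpy]; exact pulls_le_sq_mul hy (by linarith) hd1 hxy
  have hdr : d ^ 2 ≤ r := by
    have : 0 ≤ δ * d ^ 2 := by positivity
    linarith
  have hd2 : 1 ≤ d ^ 2 := one_le_pow₀ hd1
  have hP := pulls_pos (by linarith : 0 < x + Δ) σ₂
  have hM' : 1 ≤ δ * (n₁ + n₂) := by
    have := mul_le_mul_of_nonneg_left hM₁ hδ0.le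
    have h3 : δ * (2 / δ + 2) = 2 + 2 * δ := by field_simp
    have h4 : 0 ≤ δ * n₂ := by positivity
    linarith
  have hle : pulls σ₁ x + pulls σ₂ (x + Δ) ≤ r * T := by
    have e1 : 1 * n₁ ≤ d ^ 2 * n₁ := by gcongr
    have e2 : d ^ 2 * (n₁ + n₂) ≤ r * T := by gcongr; linarith
    rw [hpx]; linarith
  have hge : T ≤ r * (pulls σ₁ x + pulls σ₂ (x + Δ)) := by
    rw [hpx]
    have e1 : 1 * n₁ ≤ d ^ 2 * n₁ := by gcongr
    calc T ≤ (1 + δ) * (n₁ + n₂) := by linarith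
      _ ≤ (1 + δ) * (d ^ 2 * (n₁ + pulls σ₂ (x + Δ))) := by gcongr; linarith
      _ = (1 + δ) * d ^ 2 * (n₁ + pulls σ₂ (x + Δ)) := by ring
      _ ≤ _ := by gcongr
  obtain ⟨hxz, hzx⟩ := hstab T σ₁ σ₂ Δ x z (by linarith) hσ₁ hσ₂ hΔ hx hz hH
    (by rw [hpz]; exact hmT) hle hge
  have hs2 : 0 < s ^ 2 := by positivity
  have hs3 : s ^ 2 ≤ s ^ 3 := pow_le_pow_right₀ hs.le (by norm_num)
  have hsΔ : Δ ≤ s * Δ := le_mul_of_one_le_left hΔ hs.le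
  have hxz' : x + Δ ≤ s * (z + Δ) := by linarith
  have hzx' : z + Δ ≤ s * (x + Δ) := by linarith
  have hPz := pulls_pos (by linarith : 0 < z + Δ) σ₂
  have e1 : n₁ ≤ s ^ 2 * m := by
    have := pulls_le_sq_mul (σ := σ₁) hx hz hs.le hzx
    rwa [hpx, hpz] at this
  have e2 : m ≤ s ^ 2 * n₁ := by
    have := pulls_le_sq_mul (σ := σ₁) hz hx hs.le hxz
    rwa [hpx, hpz] at this
  have e3 := pulls_le_sq_mul (σ := σ₂) (by linarith) (by linarith) hs.le hxz'
  have e4 := pulls_le_sq_mul (σ := σ₂) (by linarith) (by linarith) hs.le hzx'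
  have hds : d ^ 2 ≤ s := hdr.trans hrs
  refine ⟨⟨e1.trans (by gcongr), e2.trans (by gcongr)⟩, ?_, ?_⟩
  · calc n₂ ≤ d ^ 2 * pulls σ₂ (x + Δ) := hB
      _ ≤ s * (s ^ 2 * pulls σ₂ (z + Δ)) := by gcongr
      _ = _ := by ring
  · calc pulls σ₂ (z + Δ) ≤ s ^ 2 * pulls σ₂ (x + Δ) := e3
      _ ≤ s ^ 2 * (s * n₂) := by gcongr; exact hA.trans (by gcongr)
      _ = _ := by ring

/-! ### Ville's inequality -/

section Ville

variable {Ω : Type*} {mΩ : MeasurableSpace Ω}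

/-- Ville's maximal inequality for a nonnegative supermartingale with values in `ℝ≥0∞`. -/
theorem mul_measure_exists_le_lintegral {P : Measure Ω} (ℱ : Filtration ℕ mΩ)
    {M : ℕ → Ω → ℝ≥0∞} {N : ℕ} (hM : ∀ t ≤ N, Measurable[ℱ t] (M t))
    (hsuper : ∀ t < N, ∀ H, MeasurableSet[ℱ t] H →
      ∫⁻ ω in H, M (t + 1) ω ∂P ≤ ∫⁻ ω in H, M t ω ∂P) (c : ℝ≥0∞) :
    c * P {ω | ∃ t ≤ N, c ≤ M t ω} ≤ ∫⁻ ω, M 0 ω ∂P := by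
  have hmark : ∀ (D : Set Ω) (f : Ω → ℝ≥0∞), MeasurableSet D → (∀ ω ∈ D, c ≤ f ω) →
      c * P D ≤ ∫⁻ ω in D, f ω ∂P := fun D f hD hf => by
    rw [← setLIntegral_const]
    exact setLIntegral_mono' hD hf
  -- stop at the first time that the level `c` is reached
  have key : ∀ n ≤ N, MeasurableSet[ℱ n] {ω | ∃ t ≤ n, c ≤ M t ω} ∧
      c * P {ω | ∃ t ≤ n, c ≤ M t ω} + ∫⁻ ω in {ω | ∃ t ≤ n, c ≤ M t ω}ᶜ, M n ω ∂P ≤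
        ∫⁻ ω, M 0 ω ∂P := by
    intro n
    induction n with
    | zero =>
      intro h
      have he : {ω | ∃ t ≤ 0, c ≤ M t ω} = {ω | c ≤ M 0 ω} := by ext; simp
      have hm : MeasurableSet[ℱ 0] {ω | c ≤ M 0 ω} := (hM 0 h) measurableSet_Ici
      rw [he]
      refine ⟨hm, ?_⟩
      rw [← lintegral_add_compl (μ := P) (M 0) (ℱ.le 0 _ hm)]
      exact add_le_add_left (hmark _ _ (ℱ.le 0 _ hm) fun ω hω => hω) _
    | succ n ih =>
      intro h
      obtain ⟨hmB, hB⟩ := ih (by omega)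
      set B := {ω | ∃ t ≤ n, c ≤ M t ω}
      have hm : MeasurableSet[ℱ (n + 1)] {ω | c ≤ M (n + 1) ω} := (hM _ h) measurableSet_Ici
      set E := {ω | c ≤ M (n + 1) ω}
      have he : {ω | ∃ t ≤ n + 1, c ≤ M t ω} = B ∪ Bᶜ ∩ E := by
        ext ω
        simp only [Set.mem_union, Set.mem_inter_iff, Set.mem_compl_iff, Set.mem_ofPred_eq, B, E]
        constructor
        · rintro ⟨t, ht, htM⟩
          by_cases hb : ∃ t ≤ n, c ≤ M t ω
          · exact Or.inl hb
          · rcases Nat.lt_or_ge t (n + 1) with h1 | h1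
            · exact absurd ⟨t, by omega, htM⟩ hb
            · obtain rfl : t = n + 1 := by omega
              exact Or.inr ⟨hb, htM⟩
        · rintro (⟨t, ht, htM⟩ | ⟨-, h2⟩)
          · exact ⟨t, by omega, htM⟩
          · exact ⟨n + 1, le_rfl, h2⟩
      have hmB' : MeasurableSet[ℱ (n + 1)] B := ℱ.mono n.le_succ _ hmB
      have hmD : MeasurableSet[ℱ (n + 1)] (Bᶜ ∩ E) := hmB'.compl.inter hm
      rw [he]
      refine ⟨hmB'.union hmD, ?_⟩
      have hc : (B ∪ Bᶜ ∩ E)ᶜ = Bᶜ \ E := by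
        ext ω; simp only [Set.mem_compl_iff, Set.mem_union, Set.mem_inter_iff, Set.mem_sdiff]
        tauto
      calc c * P (B ∪ Bᶜ ∩ E) + ∫⁻ ω in (B ∪ Bᶜ ∩ E)ᶜ, M (n + 1) ω ∂P
          ≤ c * (P B + P (Bᶜ ∩ E)) + ∫⁻ ω in Bᶜ \ E, M (n + 1) ω ∂P := by
            rw [hc]; gcongr; exact measure_union_le _ _
        _ = c * P B + (c * P (Bᶜ ∩ E) + ∫⁻ ω in Bᶜ \ E, M (n + 1) ω ∂P) := by ring
        _ ≤ c * P B + (∫⁻ ω in Bᶜ ∩ E, M (n + 1) ω ∂P + ∫⁻ ω in Bᶜ \ E, M (n + 1) ω ∂P) := by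
            gcongr
            exact hmark _ _ (ℱ.le _ _ hmD) fun ω hω => hω.2
        _ = c * P B + ∫⁻ ω in Bᶜ, M (n + 1) ω ∂P := by
            rw [lintegral_inter_add_sdiff _ _ (ℱ.le _ _ hm)]
        _ ≤ c * P B + ∫⁻ ω in Bᶜ, M n ω ∂P := by
            gcongr 1
            exact hsuper n (by omega) _ hmB.compl
        _ ≤ _ := hB
  exact le_self_add.trans (key N le_rfl).2

end Ville

/-! ### The conditional law of the rewards and a uniform maximal inequality -/

section Run

variable {Ω : Type*} [mΩ : MeasurableSpace Ω] {K : ℕ} {ρ : ℝ} {T : ℕ} {ν : Fin K → Measure ℝ}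
  {P : Measure Ω} {ℱ : Filtration ℕ (inferInstance : MeasurableSpace Ω)}
  {A : ℕ → Ω → Fin K} {X : ℕ → Ω → ℝ}

lemma IsRun.measurableSet_arm (h : IsRun ρ T ν P ℱ A X) {t : ℕ} (ht : t ∈ Finset.Icc 1 T)
    (a : Fin K) : MeasurableSet[ℱ (t - 1)] {ω | A t ω = a} :=
  h.measurable_arm t ht (measurableSet_singleton a)

/-- On the event that arm `a` is pulled in round `t`, the reward is independent of the past. -/
lemma IsRun.lintegral_mul_reward [IsFiniteMeasure P] (h : IsRun ρ T ν P ℱ A X) {t : ℕ}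
    (ht : t ∈ Finset.Icc 1 T) (a : Fin K) {g : Ω → ℝ≥0∞} (hg : Measurable[ℱ (t - 1)] g)
    {f : ℝ → ℝ≥0∞} (hf : Measurable f) :
    ∫⁻ ω in {ω | A t ω = a}, g ω * f (X t ω) ∂P =
      (∫⁻ ω in {ω | A t ω = a}, g ω ∂P) * ∫⁻ x, f x ∂ν a := by
  have hX : Measurable (X t) := (h.measurable_reward t ht).mono (ℱ.le t) le_rfl
  have hg' : Measurable g := hg.mono (ℱ.le _) le_rfl
  have hS : MeasurableSet {ω | A t ω = a} := ℱ.le _ _ (h.measurableSet_arm ht a)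
  set S := {ω | A t ω = a}
  have h1 : ∀ B, MeasurableSet B →
      ∫⁻ ω in X t ⁻¹' B ∩ S, g ω ∂P = ν a B * ∫⁻ ω in S, g ω ∂P := by
    intro B hB
    have htrim : (P.restrict (X t ⁻¹' B ∩ S)).trim (ℱ.le (t - 1)) =
        ν a B • (P.restrict S).trim (ℱ.le (t - 1)) := by
      refine @Measure.ext _ (ℱ (t - 1)) _ _ fun H hH => ?_
      rw [Measure.smul_apply, trim_measurableSet_eq _ hH, trim_measurableSet_eq _ hH,
        Measure.restrict_apply (ℱ.le _ _ hH), Measure.restrict_apply (ℱ.le _ _ hH), smul_eq_mul,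
        mul_comm, ← h.law_reward t ht a H B hH hB]
      congr 1
      ext ω
      simp only [Set.mem_inter_iff, Set.mem_preimage, Set.mem_ofPred_eq, S]
      tauto
    rw [← lintegral_trim (ℱ.le (t - 1)) hg, htrim, lintegral_smul_measure,
      lintegral_trim (ℱ.le (t - 1)) hg, smul_eq_mul]
  have h2 : Measure.map (X t) ((P.restrict S).withDensity g) = (∫⁻ ω in S, g ω ∂P) • ν a := by
    ext B hB
    rw [Measure.map_apply hX hB, withDensity_apply _ (hX hB),
      Measure.restrict_restrict (hX hB), h1 B hB, Measure.smul_apply, smul_eq_mul, mul_comm]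
  calc ∫⁻ ω in S, g ω * f (X t ω) ∂P
      = ∫⁻ ω, f (X t ω) ∂(P.restrict S).withDensity g :=
        (lintegral_withDensity_eq_lintegral_mul _ hg' (hf.comp hX)).symm
    _ = ∫⁻ x, f x ∂Measure.map (X t) ((P.restrict S).withDensity g) := (lintegral_map hf hX).symm
    _ = (∫⁻ ω in S, g ω ∂P) * ∫⁻ x, f x ∂ν a := by
        rw [h2, lintegral_smul_measure, smul_eq_mul]

lemma IsRun.ae_reward_mem (h : IsRun ρ T ν P ℱ A X) {B : Set ℝ} (hB : MeasurableSet B)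
    (hν : ∀ a, ∀ᵐ x ∂ν a, x ∈ B) : ∀ᵐ ω ∂P, ∀ t ∈ Finset.Icc 1 T, X t ω ∈ B := by
  rw [eventually_all_finset]
  intro t ht
  have h1 : ∀ a, ∀ᵐ ω ∂P, A t ω = a → X t ω ∈ B := fun a => by
    have h2 := h.law_reward t ht a Set.univ Bᶜ MeasurableSet.univ hB.compl
    rw [show ν a Bᶜ = 0 from hν a, mul_zero] at h2
    rw [ae_iff]
    convert h2 using 2
    ext ω
    simp
  filter_upwards [eventually_all.2 h1] with ω hω using hω (A t ω) rfl

/-- The exponential supermartingale of the rewards of arm `a`, transformed by `f`. -/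
noncomputable def expReward (A : ℕ → Ω → Fin K) (X : ℕ → Ω → ℝ) (a : Fin K) (f : ℝ → ℝ)
    (l v : ℝ) (t : ℕ) (ω : Ω) : ℝ≥0∞ :=
  ∏ s ∈ Finset.Ico 1 (t + 1),
    if A s ω = a then ENNReal.ofReal (Real.exp (l * f (X s ω) - l ^ 2 * v)) else 1

omit mΩ in
lemma expReward_eq (a : Fin K) (f : ℝ → ℝ) (l v : ℝ) (t : ℕ) (ω : Ω) :
    expReward A X a f l v t ω = ENNReal.ofReal (Real.exp
      (l * ∑ s ∈ (Finset.Ico 1 (t + 1)).filter (fun s => A s ω = a), f (X s ω) -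
        l ^ 2 * v * pullCount A a (t + 1) ω)) := by
  rw [expReward, ← Finset.prod_filter,
    ← ENNReal.ofReal_prod_of_nonneg fun _ _ => (Real.exp_pos _).le, ← Real.exp_sum,
    Finset.sum_sub_distrib, ← Finset.mul_sum, Finset.sum_const, nsmul_eq_mul, pullCount]
  congr 3
  ring

lemma IsRun.measurable_expReward (h : IsRun ρ T ν P ℱ A X) (a : Fin K) {f : ℝ → ℝ}
    (hf : Measurable f) (l v : ℝ) {t : ℕ} (ht : t ≤ T) :
    Measurable[ℱ t] (expReward A X a f l v t) := by
  unfold expReward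
  refine Finset.measurable_fun_prod _ fun s hs => ?_
  rw [Finset.mem_Ico] at hs
  have hs' : s ∈ Finset.Icc 1 T := Finset.mem_Icc.2 (by omega)
  have hX : Measurable[ℱ t] (X s) :=
    (h.measurable_reward s hs').mono (ℱ.mono (by omega)) le_rfl
  refine Measurable.ite (ℱ.mono (by omega : s - 1 ≤ t) _ (h.measurableSet_arm hs' a)) ?_
    measurable_const
  have : Measurable fun x => ENNReal.ofReal (Real.exp (l * f x - l ^ 2 * v)) := by fun_prop
  exact this.comp hX

/-- A Bernstein-type bound for the moment generating function. -/
lemma lintegral_exp_le_one {ν : Measure ℝ} [IsProbabilityMeasure ν] {f : ℝ → ℝ}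
    (hf : Measurable f) (hf1 : ∀ᵐ x ∂ν, |f x| ≤ 1) (hf0 : ∫ x, f x ∂ν = 0) {v : ℝ}
    (hfv : ∫ x, f x ^ 2 ∂ν ≤ v) {l : ℝ} (hl0 : 0 ≤ l) (hl1 : l ≤ 1) :
    ∫⁻ x, ENNReal.ofReal (Real.exp (l * f x - l ^ 2 * v)) ∂ν ≤ 1 := by
  have hi1 : Integrable f ν :=
    Integrable.of_bound hf.aestronglyMeasurable 1 (by simpa using hf1)
  have hi2 : Integrable (fun x => f x ^ 2) ν := by
    refine Integrable.of_bound (hf.pow_const 2).aestronglyMeasurable 1 ?_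
    filter_upwards [hf1] with x hx
    rw [Real.norm_eq_abs, abs_pow]
    exact pow_le_one₀ (abs_nonneg _) hx
  have hg : Integrable (fun x => Real.exp (-(l ^ 2 * v)) * (1 + l * f x + l ^ 2 * f x ^ 2)) ν :=
    (((integrable_const 1).add (hi1.const_mul l)).add (hi2.const_mul _)).const_mul _
  have hpt : ∀ᵐ x ∂ν, Real.exp (l * f x - l ^ 2 * v) ≤
      Real.exp (-(l ^ 2 * v)) * (1 + l * f x + l ^ 2 * f x ^ 2) := by
    filter_upwards [hf1] with x hx
    have h1 : |l * f x| ≤ 1 := by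
      rw [abs_mul, abs_of_nonneg hl0]
      exact mul_le_one₀ hl1 (abs_nonneg _) hx
    have h2 := (abs_le.1 (Real.abs_exp_sub_one_sub_id_le h1)).2
    rw [sub_eq_neg_add, Real.exp_add]
    gcongr
    nlinarith
  calc ∫⁻ x, ENNReal.ofReal (Real.exp (l * f x - l ^ 2 * v)) ∂ν
      ≤ ∫⁻ x, ENNReal.ofReal
          (Real.exp (-(l ^ 2 * v)) * (1 + l * f x + l ^ 2 * f x ^ 2)) ∂ν := by
        refine lintegral_mono_ae ?_
        filter_upwards [hpt] with x hx using ENNReal.ofReal_le_ofReal hx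
    _ = ENNReal.ofReal
          (∫ x, Real.exp (-(l ^ 2 * v)) * (1 + l * f x + l ^ 2 * f x ^ 2) ∂ν) := by
        refine (ofReal_integral_eq_lintegral_ofReal hg ?_).symm
        filter_upwards [hpt] with x hx using (Real.exp_pos _).le.trans hx
    _ ≤ 1 := by
        rw [ENNReal.ofReal_le_one, integral_const_mul, integral_add, integral_add,
          integral_const_mul, integral_const_mul, hf0]
        · simp only [integral_const, probReal_univ, smul_eq_mul, mul_one, mul_zero, add_zero]
          rw [Real.exp_neg, inv_mul_le_one₀ (Real.exp_pos _)]
          calc 1 + l ^ 2 * ∫ x, f x ^ 2 ∂ν ≤ l ^ 2 * v + 1 := by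
                rw [add_comm]; gcongr
            _ ≤ _ := Real.add_one_le_exp _
        · exact integrable_const 1
        · exact hi1.const_mul l
        · exact (integrable_const 1).add (hi1.const_mul l)
        · exact hi2.const_mul _

lemma IsRun.lintegral_expReward_succ_le [IsFiniteMeasure P] (h : IsRun ρ T ν P ℱ A X) {a : Fin K}
    {f : ℝ → ℝ} (hf : Measurable f) {l v : ℝ}
    (hmgf : ∫⁻ x, ENNReal.ofReal (Real.exp (l * f x - l ^ 2 * v)) ∂ν a ≤ 1) {t : ℕ} (ht : t < T)
    {H : Set Ω} (hH : MeasurableSet[ℱ t] H) :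
    ∫⁻ ω in H, expReward A X a f l v (t + 1) ω ∂P ≤
      ∫⁻ ω in H, expReward A X a f l v t ω ∂P := by
  have ht' : t + 1 ∈ Finset.Icc 1 T := Finset.mem_Icc.2 (by omega)
  have hS : MeasurableSet {ω | A (t + 1) ω = a} := ℱ.le _ _ (h.measurableSet_arm ht' a)
  have hH' : MeasurableSet H := ℱ.le _ _ hH
  have hM := h.measurable_expReward a hf l v ht.le
  set M := expReward A X a f l v
  have hsucc : ∀ ω, M (t + 1) ω = M t ω * if A (t + 1) ω = a then
      ENNReal.ofReal (Real.exp (l * f (X (t + 1) ω) - l ^ 2 * v)) else 1 := fun ω =>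
    Finset.prod_Ico_succ_top (by omega) _
  set S := {ω | A (t + 1) ω = a}
  rw [← lintegral_inter_add_sdiff _ H hS, ← lintegral_inter_add_sdiff (M t) H hS]
  refine add_le_add ?_ (le_of_eq ?_)
  · calc ∫⁻ ω in H ∩ S, M (t + 1) ω ∂P
        = ∫⁻ ω in H ∩ S,
            M t ω * ENNReal.ofReal (Real.exp (l * f (X (t + 1) ω) - l ^ 2 * v)) ∂P := by
          refine setLIntegral_congr_fun (hH'.inter hS) fun ω hω => ?_
          simp only [hsucc, if_pos (show A (t + 1) ω = a from hω.2)]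
      _ = ∫⁻ ω in S, H.indicator (M t) ω *
            ENNReal.ofReal (Real.exp (l * f (X (t + 1) ω) - l ^ 2 * v)) ∂P := by
          rw [← Measure.restrict_restrict hH', ← lintegral_indicator hH']
          refine lintegral_congr fun ω => ?_
          by_cases hω : ω ∈ H <;> simp [hω]
      _ = (∫⁻ ω in S, H.indicator (M t) ω ∂P) *
            ∫⁻ x, ENNReal.ofReal (Real.exp (l * f x - l ^ 2 * v)) ∂ν a :=
          h.lintegral_mul_reward ht' a (hM.indicator hH)
            (f := fun x => ENNReal.ofReal (Real.exp (l * f x - l ^ 2 * v))) (by fun_prop)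
      _ ≤ (∫⁻ ω in S, H.indicator (M t) ω ∂P) * 1 := by gcongr
      _ = ∫⁻ ω in H ∩ S, M t ω ∂P := by
          rw [mul_one, lintegral_indicator hH', Measure.restrict_restrict hH']
  · refine setLIntegral_congr_fun (hH'.diff hS) fun ω hω => ?_
    simp only [hsucc, if_neg (show ¬ A (t + 1) ω = a from hω.2), mul_one]

/-- For each slope `l`, the centered sums stay below a line in the number of pulls. -/
lemma IsRun.measure_exists_line_le [IsProbabilityMeasure P] [∀ a, IsProbabilityMeasure (ν a)]
    (h : IsRun ρ T ν P ℱ A X) {a : Fin K} {f : ℝ → ℝ} (hf : Measurable f)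
    (hf1 : ∀ᵐ x ∂ν a, |f x| ≤ 1) (hf0 : ∫ x, f x ∂ν a = 0) {v : ℝ}
    (hfv : ∫ x, f x ^ 2 ∂ν a ≤ v) {l : ℝ} (hl0 : 0 < l) (hl1 : l ≤ 1) (u : ℝ) :
    P {ω | ∃ t ≤ T, l * v * pullCount A a (t + 1) ω + u / l ≤
      ∑ s ∈ (Finset.Ico 1 (t + 1)).filter (fun s => A s ω = a), f (X s ω)} ≤
        ENNReal.ofReal (Real.exp (-u)) := by
  have hmgf := lintegral_exp_le_one hf hf1 hf0 hfv hl0.le hl1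
  have hv := mul_measure_exists_le_lintegral (P := P) ℱ (M := expReward A X a f l v) (N := T)
    (fun t ht => h.measurable_expReward a hf l v ht)
    (fun t ht H hH => h.lintegral_expReward_succ_le hf hmgf ht hH)
    (ENNReal.ofReal (Real.exp u))
  have h0 : ∫⁻ ω, expReward A X a f l v 0 ω ∂P = 1 := by simp [expReward]
  rw [h0] at hv
  have hpos : ENNReal.ofReal (Real.exp u) ≠ 0 := by
    simpa using Real.exp_pos u
  rw [Real.exp_neg, ENNReal.ofReal_inv_of_pos (Real.exp_pos u)]
  refine (measure_mono ?_).trans (ENNReal.le_inv_iff_mul_le.2 ((mul_comm _ _).trans_le hv))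
  rintro ω ⟨t, ht, hle⟩
  refine ⟨t, ht, ?_⟩
  rw [expReward_eq]
  gcongr
  have h1 := mul_le_mul_of_nonneg_left hle hl0.le
  have h2 : l * (u / l) = u := mul_div_cancel₀ u hl0.ne'
  rw [mul_add, h2] at h1
  linarith

omit mΩ in
lemma pullCount_succ_le (a : Fin K) (t : ℕ) (ω : Ω) : pullCount A a (t + 1) ω ≤ t :=
  (Finset.card_filter_le _ _).trans (by simp)

/-- The lines with slopes `δ / 4 / 2 ^ k` have the curve `δ * L * max (b * √n) 1` above their
lower envelope. -/
lemma exists_line_le {δ L b n T : ℝ} (hδ : 0 < δ) (hL : 0 < L) (hb : 0 ≤ b) (hb1 : b ≤ 1)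
    (hn : 0 ≤ n) (hnT : n ≤ T) (hT : 1 ≤ T) :
    ∃ k ∈ Finset.range (⌊2 * Real.log T⌋₊ + 1),
      δ / 4 / 2 ^ k * (L * b ^ 2) * n + δ ^ 2 * L / 16 / (δ / 4 / 2 ^ k) ≤
        δ * L * max (b * √n) 1 := by
  set w := max (b * √n) 1 with hw
  obtain ⟨k, hk1, hk2⟩ := exists_nat_pow_near (le_max_right (b * √n) 1) (one_lt_two (α := ℝ))
  rw [← hw] at hk1 hk2
  have hwT : w ≤ T := by
    refine max_le ?_ hT
    have h1 : √n ≤ √T := Real.sqrt_le_sqrt hnT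
    have h2 : √T ≤ T := (Real.sqrt_le_left (by linarith)).2 (by nlinarith)
    calc b * √n ≤ 1 * T := by gcongr; exact h1.trans h2
      _ = T := one_mul T
  have h2k : (0 : ℝ) < 2 ^ k := by positivity
  refine ⟨k, ?_, ?_⟩
  · rw [Finset.mem_range, Nat.lt_succ_iff]
    refine Nat.le_floor ?_
    have h1 := Real.log_le_log h2k (hk1.trans hwT)
    rw [Real.log_pow] at h1
    have h2 : (1 / 2 : ℝ) ≤ Real.log 2 := by linarith [Real.log_two_gt_d9]
    have h3 : (k : ℝ) * (1 / 2) ≤ k * Real.log 2 := by gcongr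
    linarith
  · have hw0 : 0 < w := zero_lt_one.trans_le (le_max_right _ _)
    have h1 : b ^ 2 * n ≤ w ^ 2 := by
      calc b ^ 2 * n = (b * √n) ^ 2 := by rw [mul_pow, Real.sq_sqrt hn]
        _ ≤ w ^ 2 := by gcongr; exact le_max_left _ _
    have h2 : w / 2 ^ k ≤ 2 := by
      rw [div_le_iff₀ h2k]
      calc w ≤ 2 ^ (k + 1) := hk2.le
        _ = 2 * 2 ^ k := by ring
    have h3 : δ / 4 / 2 ^ k * (L * b ^ 2) * n ≤ δ * L * w / 2 := by
      calc δ / 4 / 2 ^ k * (L * b ^ 2) * n = δ / 4 / 2 ^ k * L * (b ^ 2 * n) := by ring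
        _ ≤ δ / 4 / 2 ^ k * L * w ^ 2 := by gcongr
        _ = δ * L * w / 4 * (w / 2 ^ k) := by ring
        _ ≤ δ * L * w / 4 * 2 := by gcongr
        _ = _ := by ring
    have h4 : δ ^ 2 * L / 16 / (δ / 4 / 2 ^ k) = δ * L * 2 ^ k / 4 := by field_simp; norm_num
    have h5 : δ * L * 2 ^ k / 4 ≤ δ * L * w / 4 := by gcongr
    have h6 : 0 < δ * L * w := by positivity
    rw [h4]; linarith

/-- A maximal inequality that is uniform over the number of pulls. The variance proxy is written
`L * b ^ 2` and `L * max (b * √n) 1` is then `L * n * phi n b`. -/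
lemma IsRun.measure_exists_lt_sum_le [IsProbabilityMeasure P] [∀ a, IsProbabilityMeasure (ν a)]
    (h : IsRun ρ T ν P ℱ A X) (hT : 1 ≤ T) {a : Fin K} {f : ℝ → ℝ} (hf : Measurable f)
    (hf1 : ∀ᵐ x ∂ν a, |f x| ≤ 1) (hf0 : ∫ x, f x ∂ν a = 0) {b L δ : ℝ} (hb : 0 ≤ b) (hb1 : b ≤ 1)
    (hL : 0 < L) (hfv : ∫ x, f x ^ 2 ∂ν a ≤ L * b ^ 2) (hδ : 0 < δ) (hδ1 : δ ≤ 1) :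
    P {ω | ∃ t ≤ T, δ * L * max (b * √(pullCount A a (t + 1) ω)) 1 <
      ∑ s ∈ (Finset.Ico 1 (t + 1)).filter (fun s => A s ω = a), f (X s ω)} ≤
        ENNReal.ofReal ((2 * Real.log T + 1) * Real.exp (-(δ ^ 2 * L / 16))) := by
  have hT' : (1 : ℝ) ≤ T := by exact_mod_cast hT
  have hlog : 0 ≤ Real.log T := Real.log_nonneg hT'
  set S : ℕ → Set Ω := fun k => {ω | ∃ t ≤ T,
    δ / 4 / 2 ^ k * (L * b ^ 2) * pullCount A a (t + 1) ω + δ ^ 2 * L / 16 / (δ / 4 / 2 ^ k) ≤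
      ∑ s ∈ (Finset.Ico 1 (t + 1)).filter (fun s => A s ω = a), f (X s ω)}
  have hsub : {ω | ∃ t ≤ T, δ * L * max (b * √(pullCount A a (t + 1) ω)) 1 <
      ∑ s ∈ (Finset.Ico 1 (t + 1)).filter (fun s => A s ω = a), f (X s ω)} ⊆
      ⋃ k ∈ Finset.range (⌊2 * Real.log T⌋₊ + 1), S k := by
    rintro ω ⟨t, ht, hlt⟩
    have hn : (pullCount A a (t + 1) ω : ℝ) ≤ T := by
      exact_mod_cast (pullCount_succ_le a t ω).trans ht
    obtain ⟨k, hk, hle⟩ := exists_line_le hδ hL hb hb1 (Nat.cast_nonneg _) hn hT'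
    exact Set.mem_biUnion hk ⟨t, ht, hle.trans hlt.le⟩
  calc _ ≤ P (⋃ k ∈ Finset.range (⌊2 * Real.log T⌋₊ + 1), S k) := measure_mono hsub
    _ ≤ ∑ k ∈ Finset.range (⌊2 * Real.log T⌋₊ + 1), P (S k) := measure_biUnion_finset_le _ _
    _ ≤ ∑ k ∈ Finset.range (⌊2 * Real.log T⌋₊ + 1),
          ENNReal.ofReal (Real.exp (-(δ ^ 2 * L / 16))) := by
        refine Finset.sum_le_sum fun k _ => ?_
        refine h.measure_exists_line_le hf hf1 hf0 hfv (by positivity) ?_ _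
        rw [div_le_one (by positivity)]
        have : (1 : ℝ) ≤ 2 ^ k := one_le_pow₀ (by norm_num)
        linarith
    _ = ENNReal.ofReal (((⌊2 * Real.log T⌋₊ + 1 : ℕ) : ℝ) * Real.exp (-(δ ^ 2 * L / 16))) := by
        rw [Finset.sum_const, Finset.card_range, nsmul_eq_mul,
          ENNReal.ofReal_mul (Nat.cast_nonneg _), ENNReal.ofReal_natCast]
    _ ≤ _ := by
        gcongr
        push_cast
        gcongr
        exact Nat.floor_le (by positivity)

end Run

/-! ### Concentration of the optimistic rewards -/

/-- Exploration widths are close as soon as the variances are, on the scale of the width. -/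
lemma abs_max_div_sqrt_sub_le {δ L n V σ : ℝ} (hδ : 0 < δ) (hδ1 : δ ≤ 1) (hn : 0 < n) (hL : 0 < L)
    (hV : 0 ≤ V) (hV1 : V ≤ 1) (hσ : 0 ≤ σ) (hσ1 : σ ≤ 1)
    (h : |V - σ ^ 2| ≤ δ * L * phi n (σ / √L) + (δ * L * phi n (σ / √L)) ^ 2) :
    |max (√V / √L) (1 / √n) - max (σ / √L) (1 / √n)| ≤ 2 * δ * max (σ / √L) (1 / √n) := by
  have hsL : 0 < √L := Real.sqrt_pos.2 hL
  have hsn : 0 < √n := Real.sqrt_pos.2 hn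
  have hw : 0 < max (σ / √L) (1 / √n) := lt_max_of_lt_right (by positivity)
  rcases le_total n L with hnL | hLn
  · -- for so few pulls both widths equal `1 / √n`
    have h1 : ∀ y : ℝ, y ≤ 1 → max (y / √L) (1 / √n) = 1 / √n := fun y hy => by
      refine max_eq_right ?_
      calc y / √L ≤ 1 / √L := by gcongr
        _ ≤ 1 / √n := by gcongr
    rw [h1 _ (Real.sqrt_le_one.2 hV1), h1 _ hσ1, sub_self, abs_zero]
    positivity
  · set w := max (σ / √L) (1 / √n)
    set W := max (√V / √L) (1 / √n)
    have hW : 0 < W := lt_max_of_lt_right (by positivity)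
    have hphi : phi n (σ / √L) = w / √n := rfl
    have hsq : ∀ y : ℝ, 0 ≤ y → max (y / √L) (1 / √n) ^ 2 = max (y ^ 2 / L) (1 / n) := by
      intro y hy
      rw [← Real.sq_sqrt hL.le, ← Real.sq_sqrt hn.le]
      simp only [Real.sqrt_sq (Real.sqrt_nonneg _), ← div_pow, ← one_div_pow]
      exact (pow_left_monotoneOn (n := 2) (M₀ := ℝ)).map_max (by simp; positivity) (by simp)
    have hW2 : W ^ 2 = max (V / L) (1 / n) := by rw [hsq _ (Real.sqrt_nonneg _), Real.sq_sqrt hV]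
    have hw2 : w ^ 2 = max (σ ^ 2 / L) (1 / n) := hsq _ hσ
    have hdiff : |W ^ 2 - w ^ 2| ≤ |V - σ ^ 2| / L := by
      rw [hW2, hw2, ← abs_of_pos hL, ← abs_div, abs_of_pos hL, sub_div]
      exact abs_max_sub_max_le_abs _ _ _
    have h1 : 1 / √n ≤ w := le_max_right _ _
    have h2 : |V - σ ^ 2| / L ≤ 2 * δ * w ^ 2 := by
      rw [hphi] at h
      rw [div_le_iff₀ hL]
      have e1 : δ * L * (w / √n) ≤ δ * w ^ 2 * L := by
        calc δ * L * (w / √n) = δ * L * w * (1 / √n) := by ring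
          _ ≤ δ * L * w * w := by gcongr
          _ = _ := by ring
      have e2 : (δ * L * (w / √n)) ^ 2 ≤ δ * w ^ 2 * L := by
        calc (δ * L * (w / √n)) ^ 2 = δ * δ * L * w ^ 2 * (L / n) := by
              rw [mul_pow, div_pow, Real.sq_sqrt hn.le]; ring
          _ ≤ δ * 1 * L * w ^ 2 * 1 := by gcongr; exact (div_le_one hn).2 hLn
          _ = _ := by ring
      linarith
    have h3 : |W - w| * w ≤ 2 * δ * w * w := by
      calc |W - w| * w ≤ |W - w| * (W + w) := by gcongr; linarith
        _ = |W ^ 2 - w ^ 2| := by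
          rw [← abs_of_pos (add_pos hW hw), ← abs_mul]; congr 1; ring
        _ ≤ _ := (hdiff.trans h2).trans_eq (by ring)
    exact le_of_mul_le_mul_right h3 hw

lemma sum_sq_sub_mean {ι : Type*} (s : Finset ι) (hs : s.Nonempty) (x : ι → ℝ) (μ : ℝ) :
    (∑ i ∈ s, (x i - (∑ j ∈ s, x j) / s.card) ^ 2) / s.card =
      (∑ i ∈ s, (x i - μ) ^ 2) / s.card - ((∑ j ∈ s, x j) / s.card - μ) ^ 2 := by
  have hc : (s.card : ℝ) ≠ 0 := by exact_mod_cast hs.card_pos.ne'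
  set m := (∑ j ∈ s, x j) / (s.card : ℝ) with hm
  have hsum : ∑ j ∈ s, x j = s.card * m := by rw [hm]; field_simp
  have h1 : ∀ i ∈ s, (x i - m) ^ 2 =
      (x i - μ) ^ 2 + (2 * (μ - m) * x i + (m ^ 2 - μ ^ 2)) := fun i _ => by ring
  rw [Finset.sum_congr rfl h1, Finset.sum_add_distrib, Finset.sum_add_distrib, ← Finset.mul_sum,
    hsum, Finset.sum_const, nsmul_eq_mul]
  field_simp
  ring

/-- If the centered sums of the rewards and of their squared deviations are small on the scale of
the bonus, the optimistic reward is close to the one with the true mean and variance. -/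
lemma ucb_close {Ω : Type*} {K : ℕ} {A : ℕ → Ω → Fin K} {X : ℕ → Ω → ℝ} {ρ δ μ σ : ℝ} {T t : ℕ}
    {a : Fin K} {ω : Ω} (hδ : 0 < δ) (hδ1 : δ ≤ 1) (hL : 0 < ρ * Real.log T)
    (hn : 0 < pullCount A a t ω)
    (hσ : 0 ≤ σ) (hσ1 : σ ≤ 1) (hμ : μ ∈ Set.Icc (0 : ℝ) 1)
    (hX : ∀ s ∈ Finset.Ico 1 t, X s ω ∈ Set.Icc (0 : ℝ) 1)
    (h1 : |∑ s ∈ (Finset.Ico 1 t).filter (fun s => A s ω = a), (X s ω - μ)| ≤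
      δ * (ρ * Real.log T) * max (σ / √(ρ * Real.log T) * √(pullCount A a t ω)) 1)
    (h2 : |∑ s ∈ (Finset.Ico 1 t).filter (fun s => A s ω = a), ((X s ω - μ) ^ 2 - σ ^ 2)| ≤
      δ * (ρ * Real.log T) * max (σ / √(ρ * Real.log T) * √(pullCount A a t ω)) 1) :
    |ucb ρ T A X a t ω -
        (μ + ρ * Real.log T * phi (pullCount A a t ω) (σ / √(ρ * Real.log T)))| ≤
      3 * δ * (ρ * Real.log T * phi (pullCount A a t ω) (σ / √(ρ * Real.log T))) := by
  have hvar : empVar A X a t ω = _ :=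
    sum_sq_sub_mean ((Finset.Ico 1 t).filter (fun s => A s ω = a))
      (Finset.card_pos.1 hn) (fun s => X s ω) μ
  change _ = (∑ s ∈ (Finset.Ico 1 t).filter (fun s => A s ω = a), (X s ω - μ) ^ 2) /
    (pullCount A a t ω : ℝ) - (empMean A X a t ω - μ) ^ 2 at hvar
  have hV0 : 0 ≤ empVar A X a t ω :=
    div_nonneg (Finset.sum_nonneg fun _ _ => sq_nonneg _) (Nat.cast_nonneg _)
  have hnR : (0 : ℝ) < pullCount A a t ω := by exact_mod_cast hn
  set L := ρ * Real.log T
  set n : ℝ := (pullCount A a t ω : ℝ) with hndef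
  have hcard : (((Finset.Ico 1 t).filter (fun s => A s ω = a)).card : ℝ) = n := rfl
  rw [← mul_phi hnR] at h1 h2
  have hmean : |empMean A X a t ω - μ| ≤ δ * L * phi n (σ / √L) := by
    have e : empMean A X a t ω - μ =
        (∑ s ∈ (Finset.Ico 1 t).filter (fun s => A s ω = a), (X s ω - μ)) / n := by
      rw [Finset.sum_sub_distrib, Finset.sum_const, nsmul_eq_mul, hcard, empMean, ← hndef]
      field_simp
    rw [e, abs_div, abs_of_pos hnR, div_le_iff₀ hnR]
    linarith
  have hV1 : empVar A X a t ω ≤ 1 := by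
    have e : ∑ s ∈ (Finset.Ico 1 t).filter (fun s => A s ω = a), (X s ω - μ) ^ 2 ≤ n := by
      calc _ ≤ ∑ s ∈ (Finset.Ico 1 t).filter (fun s => A s ω = a), (1 : ℝ) := by
            refine Finset.sum_le_sum fun s hs => ?_
            have := hX s (Finset.mem_filter.1 hs).1
            rw [sq_le_one_iff_abs_le_one, abs_le]
            constructor <;> linarith [this.1, this.2, hμ.1, hμ.2]
        _ = n := by rw [Finset.sum_const, nsmul_eq_mul, mul_one, hcard]
    have := (div_le_one hnR).2 e
    rw [hvar]
    linarith [sq_nonneg (empMean A X a t ω - μ)]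
  have hVσ : |empVar A X a t ω - σ ^ 2| ≤
      δ * L * phi n (σ / √L) + (δ * L * phi n (σ / √L)) ^ 2 := by
    have e : empVar A X a t ω - σ ^ 2 =
        (∑ s ∈ (Finset.Ico 1 t).filter (fun s => A s ω = a), ((X s ω - μ) ^ 2 - σ ^ 2)) / n -
          (empMean A X a t ω - μ) ^ 2 := by
      rw [hvar, Finset.sum_sub_distrib, Finset.sum_const, nsmul_eq_mul, hcard]
      field_simp
      ring
    rw [e]
    refine (abs_sub _ _).trans (add_le_add ?_ ?_)
    · rw [abs_div, abs_of_pos hnR, div_le_iff₀ hnR]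
      linarith
    · rw [abs_of_nonneg (sq_nonneg _), ← sq_abs]
      gcongr
  have hw := abs_max_div_sqrt_sub_le hδ hδ1 hnR hL hV0 hV1 hσ hσ1 hVσ
  have hsn : 0 < √n := Real.sqrt_pos.2 hnR
  have hphi : L * phi n (σ / √L) = max (σ / √L) (1 / √n) * (L / √n) := by
    rw [phi]; ring
  have e : ucb ρ T A X a t ω - (μ + L * phi n (σ / √L)) = (empMean A X a t ω - μ) +
      (max (√(empVar A X a t ω) / √L) (1 / √n) - max (σ / √L) (1 / √n)) * (L / √n) := by
    rw [hphi, ucb]; ring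
  rw [e]
  calc _ ≤ δ * L * phi n (σ / √L) + 2 * δ * max (σ / √L) (1 / √n) * (L / √n) := by
        refine (abs_add_le _ _).trans (add_le_add hmean ?_)
        rw [abs_mul, abs_of_pos (by positivity : 0 < L / √n)]
        gcongr
    _ = 3 * δ * (L * phi n (σ / √L)) := by rw [hphi, mul_assoc, hphi]; ring

/-! ### Moments of a distribution on the unit interval -/

section Moments

variable {ν : Measure ℝ} [IsProbabilityMeasure ν] (hν : ∀ᵐ x ∂ν, x ∈ Set.Icc (0 : ℝ) 1)
include hν

lemma integrable_of_ae_mem_Icc : Integrable (fun x : ℝ => x) ν := by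
  refine Integrable.of_bound measurable_id.aestronglyMeasurable 1 ?_
  filter_upwards [hν] with x hx
  rw [Real.norm_eq_abs, abs_le]
  constructor <;> linarith [hx.1, hx.2]

lemma armMean_mem_Icc : armMean ν ∈ Set.Icc (0 : ℝ) 1 := by
  constructor
  · exact integral_nonneg_of_ae (hν.mono fun x hx => hx.1)
  · calc armMean ν ≤ ∫ _, (1 : ℝ) ∂ν :=
        integral_mono_ae (integrable_of_ae_mem_Icc hν) (integrable_const _)
          (hν.mono fun x hx => hx.2)
      _ = 1 := by simp

lemma ae_abs_sub_armMean_le_one : ∀ᵐ x ∂ν, |x - armMean ν| ≤ 1 := by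
  have hμ := armMean_mem_Icc hν
  filter_upwards [hν] with x hx
  rw [abs_le]
  constructor <;> linarith [hx.1, hx.2, hμ.1, hμ.2]

omit hν [IsProbabilityMeasure ν] in
lemma armStd_nonneg : 0 ≤ armStd ν := Real.sqrt_nonneg _

omit hν [IsProbabilityMeasure ν] in
lemma integral_sub_armMean_sq : ∫ x, (x - armMean ν) ^ 2 ∂ν = armStd ν ^ 2 := by
  rw [armStd, Real.sq_sqrt (variance_nonneg _ _),
    variance_eq_integral (X := fun x : ℝ => x) (by fun_prop)]
  rfl

lemma integrable_sub_armMean_sq : Integrable (fun x => (x - armMean ν) ^ 2) ν := by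
  refine Integrable.of_bound (by fun_prop) 1 ?_
  filter_upwards [ae_abs_sub_armMean_le_one hν] with x hx
  rw [Real.norm_eq_abs, abs_pow]
  exact pow_le_one₀ (abs_nonneg _) hx

lemma armStd_le_one : armStd ν ≤ 1 := by
  rw [← sq_le_one_iff₀ armStd_nonneg, ← integral_sub_armMean_sq]
  calc _ ≤ ∫ _, (1 : ℝ) ∂ν := by
        refine integral_mono_ae (integrable_sub_armMean_sq hν) (integrable_const _) ?_
        filter_upwards [ae_abs_sub_armMean_le_one hν] with x hx
        rwa [sq_le_one_iff_abs_le_one]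
    _ = 1 := by simp

lemma integral_sub_armMean : ∫ x, (x - armMean ν) ∂ν = 0 := by
  rw [integral_sub (integrable_of_ae_mem_Icc hν) (integrable_const _)]
  simp [armMean]

lemma integral_sq_sub_armStd_sq : ∫ x, ((x - armMean ν) ^ 2 - armStd ν ^ 2) ∂ν = 0 := by
  rw [integral_sub (integrable_sub_armMean_sq hν) (integrable_const _), integral_sub_armMean_sq]
  simp

lemma ae_abs_sq_sub_armStd_sq_le_one :
    ∀ᵐ x ∂ν, |(x - armMean ν) ^ 2 - armStd ν ^ 2| ≤ 1 := by
  have h1 := armStd_le_one hν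
  have h0 := armStd_nonneg (ν := ν)
  filter_upwards [ae_abs_sub_armMean_le_one hν] with x hx
  have h2 : (x - armMean ν) ^ 2 ≤ 1 := by rwa [sq_le_one_iff_abs_le_one]
  have h3 : armStd ν ^ 2 ≤ 1 := pow_le_one₀ h0 h1
  rw [abs_le]
  constructor <;> linarith [sq_nonneg (x - armMean ν), sq_nonneg (armStd ν)]

/-- The squared deviation lies in `[0, 1]`, so its variance is at most its mean. -/
lemma integral_sq_sub_armStd_sq_sq_le :
    ∫ x, ((x - armMean ν) ^ 2 - armStd ν ^ 2) ^ 2 ∂ν ≤ armStd ν ^ 2 := by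
  have hi := integrable_sub_armMean_sq hν
  have hj : Integrable
      (fun x => 2 * armStd ν ^ 2 * ((x - armMean ν) ^ 2 - armStd ν ^ 2)) ν :=
    (hi.sub (integrable_const _)).const_mul _
  calc _ ≤ ∫ x, ((x - armMean ν) ^ 2 -
          2 * armStd ν ^ 2 * ((x - armMean ν) ^ 2 - armStd ν ^ 2)) ∂ν := by
        refine integral_mono_ae ?_ ?_ ?_
        · refine Integrable.of_bound (by fun_prop) 1 ?_
          filter_upwards [ae_abs_sq_sub_armStd_sq_le_one hν] with x hx
          rw [Real.norm_eq_abs, abs_pow]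
          exact pow_le_one₀ (abs_nonneg _) hx
        · exact hi.sub hj
        · filter_upwards [ae_abs_sub_armMean_le_one hν] with x hx
          have h2 : (x - armMean ν) ^ 2 ≤ 1 := by rwa [sq_le_one_iff_abs_le_one]
          have h3 := mul_le_mul_of_nonneg_left h2 (sq_nonneg (x - armMean ν))
          nlinarith [sq_nonneg (armStd ν ^ 2)]
    _ = armStd ν ^ 2 := by
        rw [integral_sub hi hj, integral_const_mul,
          integral_sq_sub_armStd_sq hν, integral_sub_armMean_sq]
        ring

end Moments

/-! ### The optimistic rewards of a run -/

/-- With high probability, the optimistic rewards are close to their deterministic counterparts at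
all rounds. -/
lemma IsRun.measure_not_ucb_close_le {Ω : Type*} [mΩ : MeasurableSpace Ω] {ρ δ : ℝ} {T : ℕ}
    {ν : Fin 2 → Measure ℝ} {P : Measure Ω} {ℱ : Filtration ℕ (inferInstance : MeasurableSpace Ω)}
    {A : ℕ → Ω → Fin 2} {X : ℕ → Ω → ℝ} [IsProbabilityMeasure P] [∀ a, IsProbabilityMeasure (ν a)]
    (h : IsRun ρ T ν P ℱ A X) (hν : ∀ a, ∀ᵐ x ∂ν a, x ∈ Set.Icc (0 : ℝ) 1) (hT : 1 ≤ T)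
    (hL : 1 ≤ ρ * Real.log T) (hδ : 0 < δ) (hδ1 : δ ≤ 1) :
    P {ω | ¬ ∀ a, ∀ t ≤ T, 0 < pullCount A a t ω →
      |ucb ρ T A X a t ω - (armMean (ν a) +
          ρ * Real.log T * phi (pullCount A a t ω) (sigmaBar ρ T (ν a)))| ≤
        3 * δ * (ρ * Real.log T * phi (pullCount A a t ω) (sigmaBar ρ T (ν a)))} ≤
      8 * ENNReal.ofReal
        ((2 * Real.log T + 1) * Real.exp (-(δ ^ 2 * (ρ * Real.log T) / 16))) := by
  have hL0 : 0 < ρ * Real.log T := by linarith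
  set L := ρ * Real.log T
  -- the four transformed rewards whose sums have to be controlled
  let f : Fin 2 → Fin 4 → ℝ → ℝ := fun a => ![fun x => x - armMean (ν a),
    fun x => -(x - armMean (ν a)), fun x => (x - armMean (ν a)) ^ 2 - armStd (ν a) ^ 2,
    fun x => -((x - armMean (ν a)) ^ 2 - armStd (ν a) ^ 2)]
  let D : Fin 2 → Fin 4 → Set Ω := fun a i => {ω | ∃ t ≤ T,
    δ * L * max (sigmaBar ρ T (ν a) * √(pullCount A a (t + 1) ω)) 1 <
      ∑ s ∈ (Finset.Ico 1 (t + 1)).filter (fun s => A s ω = a), f a i (X s ω)}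
  let N : Set Ω := {ω | ¬ ∀ t ∈ Finset.Icc 1 T, X t ω ∈ Set.Icc (0 : ℝ) 1}
  have hN : P N = 0 := h.ae_reward_mem measurableSet_Icc hν
  have hb0 : ∀ a, 0 ≤ sigmaBar ρ T (ν a) := fun a => div_nonneg armStd_nonneg (Real.sqrt_nonneg _)
  have hb1 : ∀ a, sigmaBar ρ T (ν a) ≤ 1 := fun a =>
    (div_le_one (Real.sqrt_pos.2 hL0)).2
      ((armStd_le_one (hν a)).trans (Real.one_le_sqrt.2 hL))
  have hbL : ∀ a, L * sigmaBar ρ T (ν a) ^ 2 = armStd (ν a) ^ 2 := fun a => by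
    rw [sigmaBar, div_pow, Real.sq_sqrt hL0.le]; field_simp
  have hD : ∀ a i, P (D a i) ≤ ENNReal.ofReal
      ((2 * Real.log T + 1) * Real.exp (-(δ ^ 2 * L / 16))) := by
    intro a i
    have key : ∀ g : ℝ → ℝ, Measurable g → (∀ᵐ x ∂ν a, |g x| ≤ 1) → ∫ x, g x ∂ν a = 0 →
        ∫ x, g x ^ 2 ∂ν a ≤ armStd (ν a) ^ 2 → P {ω | ∃ t ≤ T,
          δ * L * max (sigmaBar ρ T (ν a) * √(pullCount A a (t + 1) ω)) 1 <
            ∑ s ∈ (Finset.Ico 1 (t + 1)).filter (fun s => A s ω = a), g (X s ω)} ≤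
        ENNReal.ofReal ((2 * Real.log T + 1) * Real.exp (-(δ ^ 2 * L / 16))) :=
      fun g hg hg1 hg0 hgv => h.measure_exists_lt_sum_le hT hg hg1 hg0 (hb0 a) (hb1 a) hL0
        (hgv.trans (hbL a).ge) hδ hδ1
    have m1 := ae_abs_sub_armMean_le_one (hν a)
    have m2 := integral_sub_armMean (hν a)
    have m3 := (integral_sub_armMean_sq (ν := ν a)).le
    have v1 := ae_abs_sq_sub_armStd_sq_le_one (hν a)
    have v2 := integral_sq_sub_armStd_sq (hν a)
    have v3 := integral_sq_sub_armStd_sq_sq_le (hν a)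
    fin_cases i
    · exact key (fun x => x - armMean (ν a)) (by fun_prop) m1 m2 m3
    · exact key (fun x => -(x - armMean (ν a))) (by fun_prop) (by simpa only [abs_neg] using m1)
        (by rw [integral_neg, m2, neg_zero]) (by simpa only [neg_sq] using m3)
    · exact key (fun x => (x - armMean (ν a)) ^ 2 - armStd (ν a) ^ 2) (by fun_prop) v1 v2 v3
    · exact key (fun x => -((x - armMean (ν a)) ^ 2 - armStd (ν a) ^ 2)) (by fun_prop)
        (by simpa only [abs_neg] using v1)
        (by rw [integral_neg, v2, neg_zero]) (by simpa only [neg_sq] using v3)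
  have hsub : {ω | ¬ ∀ a, ∀ t ≤ T, 0 < pullCount A a t ω →
      |ucb ρ T A X a t ω - (armMean (ν a) +
          L * phi (pullCount A a t ω) (sigmaBar ρ T (ν a)))| ≤
        3 * δ * (L * phi (pullCount A a t ω) (sigmaBar ρ T (ν a)))} ⊆
      N ∪ ⋃ a, ⋃ i, D a i := by
    intro ω hω
    by_contra hcon
    simp only [Set.mem_union, Set.mem_iUnion, not_or, not_exists, N, D, Set.mem_ofPred_eq,
      not_not, not_and, not_lt] at hcon
    obtain ⟨hX, hS⟩ := hcon
    refine hω fun a t ht hpos => ?_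
    obtain ⟨t, rfl⟩ : ∃ k, t = k + 1 := by
      refine Nat.exists_eq_succ_of_ne_zero ?_
      rintro rfl
      simp [pullCount] at hpos
    have hX' : ∀ s ∈ Finset.Ico 1 (t + 1), X s ω ∈ Set.Icc (0 : ℝ) 1 := fun s hs => by
      rw [Finset.mem_Ico] at hs
      exact hX s (Finset.mem_Icc.2 (by omega))
    have s0 := hS a 0 t (by omega)
    have s1 := hS a 1 t (by omega)
    have s2 := hS a 2 t (by omega)
    have s3 := hS a 3 t (by omega)
    simp only [f, Matrix.cons_val, Finset.sum_neg_distrib] at s0 s1 s2 s3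
    exact ucb_close hδ hδ1 hL0 hpos armStd_nonneg (armStd_le_one (hν a)) (armMean_mem_Icc (hν a))
      hX' (abs_le'.2 ⟨s0, s1⟩) (abs_le'.2 ⟨s2, s3⟩)
  calc _ ≤ P (N ∪ ⋃ a, ⋃ i, D a i) := measure_mono hsub
    _ ≤ P N + ∑ a, ∑ i, P (D a i) := by
        refine (measure_union_le _ _).trans (add_le_add_right ?_ _)
        refine (measure_iUnion_fintype_le _ _).trans (Finset.sum_le_sum fun a _ => ?_)
        exact measure_iUnion_fintype_le _ _
    _ ≤ 0 + ∑ a : Fin 2, ∑ i : Fin 4, ENNReal.ofReal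
          ((2 * Real.log T + 1) * Real.exp (-(δ ^ 2 * L / 16))) := by
        rw [hN]
        exact add_le_add_right (Finset.sum_le_sum fun a _ => Finset.sum_le_sum fun i _ => hD a i) _
    _ = _ := by
        simp only [Finset.sum_const, Finset.card_univ, Fintype.card_fin, nsmul_eq_mul, zero_add]
        rw [← mul_assoc]
        norm_num

/-! ### Pull counts along a run -/

section Counts

variable {Ω : Type*} {K : ℕ} {A : ℕ → Ω → Fin K} {ω : Ω}

lemma pullCount_mono (a : Fin K) {t T : ℕ} (h : t ≤ T) : pullCount A a t ω ≤ pullCount A a T ω :=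
  Finset.card_le_card (Finset.filter_subset_filter _ (Finset.Ico_subset_Ico_right h))

lemma pullCount_pos (hinit : ∀ a, ∃ t ∈ Finset.Icc 1 K, A t ω = a) (a : Fin K) {t : ℕ}
    (ht : K < t) : 0 < pullCount A a t ω := by
  obtain ⟨s, hs, hsa⟩ := hinit a
  rw [Finset.mem_Icc] at hs
  exact Finset.card_pos.2 ⟨s, Finset.mem_filter.2 ⟨Finset.mem_Ico.2 (by omega), hsa⟩⟩

lemma pullCount_add_pullCount {A : ℕ → Ω → Fin 2} {T : ℕ} (hT : 1 ≤ T) :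
    pullCount A 0 T ω + pullCount A 1 T ω + 1 = T := by
  have h := Finset.card_filter_add_card_filter_not (s := Finset.Ico 1 T) (fun s => A s ω = 0)
  have h1 : (Finset.Ico 1 T).filter (fun s => ¬ A s ω = 0) =
      (Finset.Ico 1 T).filter (fun s => A s ω = 1) :=
    Finset.filter_congr fun s _ => by omega
  rw [h1, Nat.card_Ico] at h
  unfold pullCount
  omega

/-- The last round in which an arm that is pulled at least twice is pulled. -/
lemma exists_last_pull {A : ℕ → Ω → Fin 2} (hinit : ∀ a, ∃ t ∈ Finset.Icc 1 2, A t ω = a)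
    {a : Fin 2} {T : ℕ} (h : 2 ≤ pullCount A a T ω) :
    ∃ t, 3 ≤ t ∧ t < T ∧ A t ω = a ∧ pullCount A a t ω + 1 = pullCount A a T ω := by
  set S := (Finset.Ico 1 T).filter (fun s => A s ω = a) with hS
  have hne : S.Nonempty := Finset.card_pos.1 (by change 2 ≤ S.card at h; omega)
  have hmem := S.max'_mem hne
  have hmax := fun s hs => S.le_max' s hs
  set t := S.max' hne
  obtain ⟨htT, hta⟩ := Finset.mem_filter.1 hmem
  rw [Finset.mem_Ico] at htT
  have herase : (Finset.Ico 1 t).filter (fun s => A s ω = a) = S.erase t := by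
    ext s
    simp only [hS, Finset.mem_filter, Finset.mem_Ico, Finset.mem_erase]
    constructor
    · rintro ⟨⟨h1, h2⟩, h3⟩
      exact ⟨by omega, ⟨h1, by omega⟩, h3⟩
    · rintro ⟨h1, ⟨h2, h3⟩, h4⟩
      have := hmax s (Finset.mem_filter.2 ⟨Finset.mem_Ico.2 ⟨h2, h3⟩, h4⟩)
      exact ⟨⟨h2, by omega⟩, h4⟩
  have hcount : pullCount A a t ω + 1 = pullCount A a T ω := by
    change _ = S.card
    rw [pullCount, herase, Finset.card_erase_add_one hmem]
  refine ⟨t, ?_, htT.2, hta, hcount⟩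
  by_contra! hlt
  -- otherwise arm `a` is pulled in both initial rounds
  obtain ⟨s, hs⟩ : ((Finset.Ico 1 t).filter (fun s => A s ω = a)).Nonempty :=
    Finset.card_pos.1 (by change 0 < pullCount A a t ω; omega)
  obtain ⟨hs, hsa⟩ := Finset.mem_filter.1 hs
  rw [Finset.mem_Ico] at hs
  obtain rfl : s = 1 := by omega
  have ht2 : t = 2 := by omega
  obtain ⟨r, hr, hrb⟩ := hinit (1 - a)
  rw [Finset.mem_Icc] at hr
  have hra : A r ω = a := by
    rcases (by omega : r = 1 ∨ r = 2) with rfl | rfl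
    · exact hsa
    · exact (congrArg (A · ω) ht2).symm.trans hta
  rw [hra] at hrb
  omega

end Counts

/-- Comparison of the optimistic rewards at the last pull of arm `a`. -/
lemma IsRun.mean_add_phi_le {Ω : Type*} [mΩ : MeasurableSpace Ω] {ρ δ : ℝ} {T : ℕ}
    {ν : Fin 2 → Measure ℝ} {P : Measure Ω} {ℱ : Filtration ℕ (inferInstance : MeasurableSpace Ω)}
    {A : ℕ → Ω → Fin 2} {X : ℕ → Ω → ℝ} (h : IsRun ρ T ν P ℱ A X) {ω : Ω}
    (hL : 0 < ρ * Real.log T) (hδ1 : δ ≤ 1)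
    (hω : ∀ a, ∀ t ≤ T, 0 < pullCount A a t ω →
      |ucb ρ T A X a t ω - (armMean (ν a) +
          ρ * Real.log T * phi (pullCount A a t ω) (sigmaBar ρ T (ν a)))| ≤
        δ * (ρ * Real.log T * phi (pullCount A a t ω) (sigmaBar ρ T (ν a))))
    {a : Fin 2} (b : Fin 2) (ha : 2 ≤ pullCount A a T ω) :
    armMean (ν b) +
        (1 - δ) * (ρ * Real.log T * phi (pullCount A b T ω) (sigmaBar ρ T (ν b))) ≤
      armMean (ν a) +
        (1 + δ) * (ρ * Real.log T * phi (pullCount A a T ω - 1) (sigmaBar ρ T (ν a))) := by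
  obtain ⟨t, ht3, htT, hta, hcount⟩ := exists_last_pull (h.init ω) ha
  have hcount' : (pullCount A a T ω : ℝ) - 1 = pullCount A a t ω := by
    rw [← hcount]; push_cast; ring
  have hpa := pullCount_pos (h.init ω) a (by omega : 2 < t)
  have hpb := pullCount_pos (h.init ω) b (by omega : 2 < t)
  have hpb' : (0 : ℝ) < pullCount A b t ω := by exact_mod_cast hpb
  have hle := h.greedy t (Finset.mem_Icc.2 ⟨ht3, htT.le⟩) ω b
  rw [hta] at hle
  have h1 := (abs_le.1 (hω a t htT.le hpa)).2
  have h2 := (abs_le.1 (hω b t htT.le hpb)).1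
  have h3 : phi (pullCount A b T ω) (sigmaBar ρ T (ν b)) ≤
      phi (pullCount A b t ω) (sigmaBar ρ T (ν b)) :=
    phi_anti hpb' (Nat.cast_le.2 (pullCount_mono b htT.le))
      (div_nonneg armStd_nonneg (Real.sqrt_nonneg _))
  have h4 : (1 - δ) * (ρ * Real.log T * phi (pullCount A b T ω) (sigmaBar ρ T (ν b))) ≤
      (1 - δ) * (ρ * Real.log T * phi (pullCount A b t ω) (sigmaBar ρ T (ν b))) := by
    have : 0 ≤ 1 - δ := by linarith
    gcongr
  rw [hcount']
  linarith

/-- If one arm had a bounded number of pulls, its bonus would stay away from `0` while the bonus of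
the other arm tends to `0`. -/
lemma le_counts {M T σ₁ σ₂ Δ δ n₁ n₂ : ℝ} (hM : 2 ≤ M) (hσ₁1 : σ₁ ≤ 1) (hσ₂1 : σ₂ ≤ 1)
    (hΔ0 : 0 ≤ Δ) (hΔ : Δ ≤ 1 / (8 * M))
    (hδ : 0 < δ) (hδ1 : δ ≤ 1 / 2) (hn₁ : 1 ≤ n₁) (hn₂ : 1 ≤ n₂) (hT : n₁ + n₂ + 1 = T)
    (hTM : 36 * M ^ 2 + M + 2 ≤ T)
    (h12 : 2 ≤ n₂ → (1 - δ) * phi n₁ σ₁ + Δ ≤ (1 + δ) * phi (n₂ - 1) σ₂)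
    (h21 : 2 ≤ n₁ → (1 - δ) * phi n₂ σ₂ ≤ (1 + δ) * phi (n₁ - 1) σ₁ + Δ) :
    M ≤ n₁ ∧ M ≤ n₂ := by
  have hM0 : 0 < M := by linarith
  have hsmall : ∀ n σ : ℝ, 1 ≤ n → n < M → 1 / (2 * M) < (1 - δ) * phi n σ := fun n σ hn hnM => by
    have hn0 : 0 < n := by linarith
    calc 1 / (2 * M) = 1 / 2 * (1 / M) := by field_simp
      _ < 1 / 2 * (1 / n) := by gcongr
      _ ≤ (1 - δ) * phi n σ := by
        gcongr
        · linarith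
        · linarith
        · exact one_div_le_phi hn0 σ
  have hlarge : ∀ n σ : ℝ, σ ≤ 1 → 36 * M ^ 2 ≤ n → (1 + δ) * phi n σ ≤ 1 / (4 * M) :=
    fun n σ hσ hn => by
      have h6 : 6 * M ≤ √n := Real.le_sqrt_of_sq_le (by linarith)
      have hn1 : 1 ≤ n := by nlinarith
      calc (1 + δ) * phi n σ ≤ 3 / 2 * (1 / √n) :=
            mul_le_mul (by linarith) (phi_le_one_div_sqrt hn1 hσ) (phi_pos (by linarith) σ).le
              (by norm_num)
        _ ≤ 3 / 2 * (1 / (6 * M)) := by gcongr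
        _ = 1 / (4 * M) := by field_simp; norm_num
  have e1 : 1 / (2 * M) = 2 * (1 / (4 * M)) := by field_simp; norm_num
  have e2 : 1 / (4 * M) = 2 * (1 / (8 * M)) := by field_simp; norm_num
  have e3 : 0 < 1 / (8 * M) := by positivity
  have hM2 : 0 ≤ M ^ 2 := sq_nonneg M
  constructor <;> by_contra! hcon
  · have h1 := h12 (by nlinarith)
    have h2 := hsmall n₁ σ₁ hn₁ hcon
    have h3 := hlarge (n₂ - 1) σ₂ hσ₂1 (by linarith)
    linarith
  · have h1 := h21 (by nlinarith)
    have h2 := hsmall n₂ σ₂ hn₂ hcon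
    have h3 := hlarge (n₁ - 1) σ₁ hσ₁1 (by linarith)
    linarith

/-! ### Convergence in probability -/

lemma stabilityQuantity_le_imp {ρ : ℝ} {T : ℕ} {ν : Fin 2 → Measure ℝ} {C : ℝ} (hC : 0 < C)
    (hT : 0 < T)
    (h : stabilityQuantity ρ T ν ≤ ENNReal.ofReal C) :
    deltaBar ρ T ν = 0 ∨
      1 / C ≤ |sigmaBar ρ T (ν 1) ^ 2 / ((T : ℝ) * deltaBar ρ T ν ^ 2) - 1| ∨
      sigmaBar ρ T (ν 1) ≤ C * max (sigmaBar ρ T (ν 0)) (1 / √(T : ℝ)) := by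
  have hT' : (0 : ℝ) < T := by exact_mod_cast hT
  rw [stabilityQuantity, min_le_iff] at h
  rcases h with h | h
  · split_ifs at h with h0
    · exact Or.inl h0
    · refine Or.inr (Or.inl ?_)
      rwa [ENNReal.inv_le_iff_inv_le, ← ENNReal.ofReal_inv_of_pos hC,
        ENNReal.ofReal_le_ofReal_iff (abs_nonneg _), ← one_div] at h
  · refine Or.inr (Or.inr ?_)
    rw [ENNReal.ofReal_le_ofReal_iff hC.le, div_le_iff₀] at h
    · exact h
    · exact lt_max_of_lt_right (by positivity)

/-- The fixed-point equation multiplied by `T`; its first term is `n` as `pulls` inverts `phi`. -/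
lemma isFixedPoint_iff {ρ : ℝ} {T : ℕ} {ν : Fin 2 → Measure ℝ} (hT : 0 < T) (n : ℝ) :
    IsFixedPoint ρ T ν n ↔ 0 < n ∧ n + pulls (sigmaBar ρ T (ν 1))
      (phi n (sigmaBar ρ T (ν 0)) + deltaBar ρ T ν) = T := by
  have hT' : (0 : ℝ) < T := by exact_mod_cast hT
  refine and_congr_right fun hn => ?_
  have hp : pulls (sigmaBar ρ T (ν 0)) (phi n (sigmaBar ρ T (ν 0))) = n :=
    pulls_phi hn (div_nonneg armStd_nonneg (Real.sqrt_nonneg _))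
  have e : ∀ σ x : ℝ, max (σ ^ 2) x / (T * x ^ 2) = pulls σ x / T := fun σ x => by
    rw [pulls, div_div, mul_comm (T : ℝ)]
  rw [e, e, ← add_div, div_eq_one_iff_eq hT'.ne', hp]

lemma abs_div_sub_one_lt {ε n m : ℝ} (hε : 0 < ε) (hm : 0 < m) (h1 : n ≤ (1 + ε / 2) * m)
    (h2 : m ≤ (1 + ε / 2) * n) : |n / m - 1| < ε := by
  have hn : 0 < n := by
    by_contra! h
    nlinarith
  rw [abs_lt, lt_sub_iff_add_lt, sub_lt_iff_lt_add, lt_div_iff₀ hm, div_lt_iff₀ hm]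
  constructor <;> nlinarith

lemma tendsto_mul_exp_neg_log {c : ℝ} (hc : 0 < c) :
    Tendsto (fun T : ℕ => (2 * Real.log T + 1) * Real.exp (-(c * Real.log T))) atTop (𝓝 0) := by
  have hy : Tendsto (fun T : ℕ => c * Real.log T) atTop atTop :=
    (Real.tendsto_log_atTop.comp tendsto_natCast_atTop_atTop).const_mul_atTop hc
  have h1 := ((Real.tendsto_pow_mul_exp_neg_atTop_nhds_zero 1).const_mul (2 / c)).add
    (Real.tendsto_pow_mul_exp_neg_atTop_nhds_zero 0)
  rw [mul_zero, add_zero] at h1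
  refine (h1.comp hy).congr fun T => ?_
  simp only [Function.comp, pow_one, pow_zero]
  field_simp

end UCBV

open UCBV in
theorem theorem3p1 {Ω : ℕ → Type*} [∀ T, MeasurableSpace (Ω T)]
    (P : ∀ T, Measure (Ω T)) [∀ T, IsProbabilityMeasure (P T)]
    (ρ : ℝ) (hρ : 1 < ρ)
    (ν : ℕ → Fin 2 → Measure ℝ) [∀ T a, IsProbabilityMeasure (ν T a)]
    (hsupp : ∀ T a, ∀ᵐ x ∂(ν T a), x ∈ Set.Icc (0 : ℝ) 1)
    (hopt : ∀ T, armMean (ν T 1) ≤ armMean (ν T 0))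
    (ℱ : ∀ T, Filtration ℕ (inferInstance : MeasurableSpace (Ω T)))
    (A : ∀ T, ℕ → Ω T → Fin 2) (X : ∀ T, ℕ → Ω T → ℝ)
    (hrun : ∀ T, 2 ≤ T → IsRun ρ T (ν T) (P T) (ℱ T) (A T) (X T))
    (hstab : limsup (fun T : ℕ => stabilityQuantity ρ T (ν T)) atTop < ⊤) :
    (∀ T : ℕ, 2 ≤ T → ∃! n : ℝ, IsFixedPoint ρ T (ν T) n) ∧
    ∀ nstar : ℕ → ℝ, (∀ T : ℕ, 2 ≤ T → IsFixedPoint ρ T (ν T) (nstar T)) →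
      TendstoInProb P (fun T ω => (pullCount (A T) 0 T ω : ℝ) / nstar T) 1 ∧
      TendstoInProb P
        (fun T ω => (pullCount (A T) 1 T ω : ℝ) / secondCount ρ T (ν T) (nstar T)) 1 := by
  have hlog : ∀ T : ℕ, 2 ≤ T → 0 < ρ * Real.log T := fun T hT =>
    mul_pos (by linarith) (Real.log_pos (by exact_mod_cast hT))
  have hb0 : ∀ T a, 0 ≤ sigmaBar ρ T (ν T a) := fun T a =>
    div_nonneg armStd_nonneg (Real.sqrt_nonneg _)
  have hΔ0 : ∀ T : ℕ, 2 ≤ T → 0 ≤ deltaBar ρ T (ν T) := fun T hT =>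
    div_nonneg (sub_nonneg.2 (hopt T)) (hlog T hT).le
  refine ⟨fun T hT => ?_, fun nstar hnstar => ?_⟩
  · simp only [isFixedPoint_iff (by omega : 0 < T)]
    exact existsUnique_add_pulls (by exact_mod_cast hT) (hb0 T 0) (hΔ0 T hT)
  -- a finite bound `C` for the stability quantity
  obtain ⟨B, hB1, hB2⟩ := exists_between hstab
  have hBC : B ≤ ENNReal.ofReal (B.toReal + 1) := by
    rw [ENNReal.ofReal_add ENNReal.toReal_nonneg zero_le_one, ENNReal.ofReal_toReal hB2.ne]
    exact le_self_add
  set C := B.toReal + 1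
  have hC : 1 ≤ C := by have := ENNReal.toReal_nonneg (a := B); simp only [C]; linarith
  have hstabC : ∀ᶠ T : ℕ in atTop, stabilityQuantity ρ T (ν T) ≤ ENNReal.ofReal C :=
    (eventually_lt_of_limsup_lt hB1).mono fun T h => h.le.trans hBC
  -- with high probability both ratios are within `ε` of `1`
  have key : ∀ ε : ℝ, 0 < ε → ∃ c : ℝ, 0 < c ∧ ∀ᶠ T : ℕ in atTop,
      P T {ω | ¬ (|(pullCount (A T) 0 T ω : ℝ) / nstar T - 1| < ε ∧
        |(pullCount (A T) 1 T ω : ℝ) / secondCount ρ T (ν T) (nstar T) - 1| < ε)} ≤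
      8 * ENNReal.ofReal ((2 * Real.log T + 1) * Real.exp (-(c * Real.log T))) := by
    intro ε hε
    set s : ℝ := (1 + ε / 2) ^ ((3 : ℕ) : ℝ)⁻¹
    have hs3 : s ^ 3 = 1 + ε / 2 := Real.rpow_inv_natCast_pow (by positivity) (by norm_num)
    have hs1 : 1 < s := Real.one_lt_rpow (by linarith) (by norm_num)
    obtain ⟨δ, hδ0, hδ2, M', hclose⟩ := counts_close hC hs1
    set M := max M' 2
    have hM2 : 2 ≤ M := le_max_right _ _
    have hlogT : Tendsto (fun T : ℕ => ρ * Real.log T) atTop atTop :=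
      (Real.tendsto_log_atTop.comp tendsto_natCast_atTop_atTop).const_mul_atTop (by linarith)
    refine ⟨(δ / 3) ^ 2 * ρ / 16, by positivity, ?_⟩
    filter_upwards [hstabC, eventually_ge_atTop 3, hlogT.eventually_ge_atTop (8 * M),
      tendsto_natCast_atTop_atTop.eventually_ge_atTop (36 * M ^ 2 + M + 2)]
      with T hTstab hT3 hTL hTM
    have hT2 : 2 ≤ T := by omega
    have hL := hlog T hT2
    have hrunT := hrun T hT2
    have hprob := hrunT.measure_not_ucb_close_le (hsupp T) (by omega) (by linarith)
      (by positivity : 0 < δ / 3) (by linarith)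
    have hexp : -((δ / 3) ^ 2 * (ρ * Real.log T) / 16) =
        -((δ / 3) ^ 2 * ρ / 16 * Real.log T) := by ring
    rw [hexp, show 3 * (δ / 3) = δ by ring] at hprob
    refine (measure_mono fun ω hbad => ?_).trans hprob
    rw [Set.mem_ofPred_eq] at hbad ⊢
    refine fun hω => hbad ?_
    obtain ⟨hm, hmT⟩ := (isFixedPoint_iff (by omega) _).1 (hnstar T hT2)
    have hb1 : ∀ a, sigmaBar ρ T (ν T a) ≤ 1 := fun a =>
      (div_le_one (Real.sqrt_pos.2 hL)).2
        ((armStd_le_one (hsupp T a)).trans (Real.one_le_sqrt.2 (by linarith)))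
    have hΔ1 : deltaBar ρ T (ν T) ≤ 1 / (8 * M) := by
      have h0 := armMean_mem_Icc (hsupp T 0)
      have h1 := armMean_mem_Icc (hsupp T 1)
      calc deltaBar ρ T (ν T) ≤ 1 / (ρ * Real.log T) := by
            unfold deltaBar; gcongr; linarith [h0.2, h1.1]
        _ ≤ _ := by gcongr
    have hsum : (pullCount (A T) 0 T ω : ℝ) + pullCount (A T) 1 T ω + 1 = T := by
      exact_mod_cast pullCount_add_pullCount (A := A T) (ω := ω) (by omega : 1 ≤ T)
    have hpos : ∀ a, (1 : ℝ) ≤ pullCount (A T) a T ω := fun a => by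
      exact_mod_cast pullCount_pos (hrunT.init ω) a (by omega : 2 < T)
    have hmul : ρ * Real.log T * deltaBar ρ T (ν T) = armMean (ν T 0) - armMean (ν T 1) :=
      mul_div_cancel₀ _ hL.ne'
    have h12 : (2 : ℝ) ≤ pullCount (A T) 1 T ω →
        (1 - δ) * phi (pullCount (A T) 0 T ω) (sigmaBar ρ T (ν T 0)) + deltaBar ρ T (ν T) ≤
          (1 + δ) * phi (pullCount (A T) 1 T ω - 1) (sigmaBar ρ T (ν T 1)) := fun h2 => by
      have := hrunT.mean_add_phi_le hL (by linarith) hω 0 (a := 1) (by exact_mod_cast h2)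
      refine le_of_mul_le_mul_left ?_ hL
      linarith
    have h21 : (2 : ℝ) ≤ pullCount (A T) 0 T ω →
        (1 - δ) * phi (pullCount (A T) 1 T ω) (sigmaBar ρ T (ν T 1)) ≤
          (1 + δ) * phi (pullCount (A T) 0 T ω - 1) (sigmaBar ρ T (ν T 0)) +
            deltaBar ρ T (ν T) := fun h2 => by
      have := hrunT.mean_add_phi_le hL (by linarith) hω 1 (a := 0) (by exact_mod_cast h2)
      refine le_of_mul_le_mul_left ?_ hL
      linarith
    obtain ⟨hM₁, hM₂⟩ := le_counts hM2 (hb1 0) (hb1 1) (hΔ0 T hT2) hΔ1 hδ0 hδ2 (hpos 0) (hpos 1)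
      hsum hTM h12 h21
    obtain ⟨⟨e1, e2⟩, e3, e4⟩ := hclose T _ _ _ _ _ _ (hb0 T 0) (hb0 T 1) (hΔ0 T hT2)
      (hM2.trans hM₁) (hM2.trans hM₂) ((le_max_left _ _).trans hM₁) ((le_max_left _ _).trans hM₂)
      hsum (stabilityQuantity_le_imp (by linarith) (by omega) hTstab)
      (h12 (hM2.trans hM₂)) (h21 (hM2.trans hM₁)) hm hmT
    rw [hs3] at e1 e2 e3 e4
    exact ⟨abs_div_sub_one_lt hε hm e1 e2, abs_div_sub_one_lt hε
      (pulls_pos (add_pos_of_pos_of_nonneg (phi_pos hm _) (hΔ0 T hT2)) _) e3 e4⟩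
  have hlim : ∀ c : ℝ, 0 < c → Tendsto (fun T : ℕ => 8 * ENNReal.ofReal
      ((2 * Real.log T + 1) * Real.exp (-(c * Real.log T)))) atTop (𝓝 0) := fun c hc => by
    have := ENNReal.Tendsto.const_mul (a := 8)
      (ENNReal.tendsto_ofReal (tendsto_mul_exp_neg_log hc)) (Or.inr (by norm_num))
    simpa using this
  constructor <;> intro ε hε <;> obtain ⟨c, hc, hev⟩ := key ε hε <;>
    refine tendsto_of_tendsto_of_tendsto_of_le_of_le' tendsto_const_nhds (hlim c hc)
      (Eventually.of_forall fun _ => zero_le) ?_ <;>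
    filter_upwards [hev] with T hT <;>
    refine (measure_mono fun ω hω hlt => ?_).trans hT
  · exact absurd hω (not_le.2 hlt.1)
  · exact absurd hω (not_le.2 hlt.2)
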